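/- Let $Z_1,\dots,Z_4\in\mathbb R^4$ with $\langle 1234\rangle=\det(Z_1,Z_2,Z_3,Z_4)>0$, use twisted cyclic labels $Z_0=-Z_4$, $Z_5=-Z_1$, let $\bar i$ be the plane $(i{-}1\,i\,i{+}1)$, and put $(abc)\cap(def)=(ab)\langle cdef\rangle+(bc)\langle adef\rangle+(ca)\langle bdef\rangle$. For $L\ge 1$ let $\mathcal R_L$ be the set of configurations of $L$ lines $AB_1,\dots,AB_L$ through a common point $A$ of real projective three-space with $\langle AB_\alpha\,\bar i\,\bar j\rangle=\langle AB_\alpha\,\bar i\cap\bar j\rangle>0$ for all $\alpha$ and all $1\le i<j\le 4$ (the intersecting cut at four points). A configuration is given by vectors $A,B_\alpha$; $(A,B_\alpha)$ and $(-A,-B_\alpha)$ are identified. A *cell* consists of a polytope in $A$-space and, for each $A$ in it, a polygon in the projective plane of lines through $A$, which all lines $AB_\alpha$ must lie in. Its canonical form is the canonical form of the polytope times the product over $\alpha$ of the canonical forms of the polygons. Canonical forms of polytopes are the rational forms with at most simple poles, all on the facets, whose residue on each facet is the canonical form of that facet (and $\pm1$ for a point, by its orientation). The canonical form of a region is the sum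 of the canonical forms of the cells of a decomposition, all oriented as the region. The measure $\langle A\,d^3A\rangle\prod_\alpha\langle AB_\alpha\,d^2B_\alpha\rangle$ is suppressed; unless said otherwise it also gives the orientation. **(1) Cells.** Up to a proper algebraic subset, $\mathcal R_L$ is the disjoint union of four cells. In them $A$ lies (up to an overall sign) in the open tetrahedron with vertices $$(Z_1,Z_2,-Z_3,-Z_4),\quad (Z_1,-Z_2,-Z_3,-Z_4),\quad (Z_1,Z_2,Z_3,Z_4),\quad (Z_1,Z_2,Z_3,-Z_4),$$ and correspondingly every $B_\alpha$ lies in the triangle with edges $$(12),(23),(34);\qquad (12),(23),(14);\qquad (12),(34),(14);\qquad (23),(34),(14),$$ on which the three brackets $\langle AB_\alpha\,\cdot\,\cdot\rangle$ with these edges are positive. The cells in $A$, and the forms in $A$, which are $+[1234],-[1234],+[1234],-[1234]$ with $$[1234]=\frac{\langle1234\rangle^3}{\langle A123\rangle\langle A234\rangle\langle A341\rangle\langle A412\rangle},$$ do not depend on $L$. **(2) Form.** The canonical form of $\mathcal R_L$ is $$\Omega_4^{(L)}=[1234]\Bigl(\prod_{\alpha}T_1(B_\alpha)-\prod_{\alpha}T_2(B_\alpha)+\prod_{\alpha}T_3(B_\alpha)-\prod_{\alpha}T_4(B_\alpha)\Bigr),$$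 where the $T_k$ are the canonical forms of the four triangles, $$T_1=\frac{\langle A123\rangle\langle A234\rangle}{\langle AB12\rangle\langle AB23\rangle\langle AB34\rangle},\qquad T_2=\frac{-\langle A123\rangle\langle A124\rangle}{\langle AB12\rangle\langle AB23\rangle\langle AB14\rangle},$$ $$T_3=\frac{-\langle A124\rangle\langle A134\rangle}{\langle AB12\rangle\langle AB34\rangle\langle AB14\rangle},\qquad T_4=\frac{-\langle A134\rangle\langle A234\rangle}{\langle AB23\rangle\langle AB34\rangle\langle AB14\rangle}.$$ **(3) Coplanar cut.** In its dual description the coplanar cut at $n=4$ is the region of lines $AB_\alpha$ through a common point with $\langle AB_\alpha ij\rangle>0$ for all $\alpha$ and $i<j$. Up to a proper algebraic subset it is the disjoint union of four cells, with the same four triangles (the same edges and inequalities) in $B_\alpha$, over the tetrahedra with vertices $(Z_1,-Z_2,-Z_3,Z_4)$, $(Z_1,Z_2,-Z_3,Z_4)$, $(Z_1,-Z_2,Z_3,-Z_4)$, $(Z_1,-Z_2,Z_3,Z_4)$. Its canonical form is the same $\Omega_4^{(L)}$, when the orientation of each loop measure is reversed (that is, the region is oriented by $(-1)^L$ times the measure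 above). Equivalently, before dualizing: the region of $L$ lines $P\cap Q_\alpha$ in a common plane $P$ with $\langle (P\cap Q_\alpha)\,\bar i\,\bar j\rangle>0$ for all $\alpha$ and $i<j$ is the dual region of the data $W_i=\bar i$ (as covectors, in the variables $P,Q_\alpha$), and it has the canonical form $\Omega_4^{(L)}$ with $Z_i,A,B_\alpha$ replaced by $W_i,P,Q_\alpha$. -/

import Mathlib

open scoped Matrix

namespace LoopCut

noncomputable section

/-! ## Brackets -/

/-- Momentum twistors: homogeneous coordinates of points of real projective three-space. -/
abbrev V4 : Type := Fin 4 → ℝ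

/-- The volume form `⟨· · · ·⟩` on `V4` (the determinant of the four rows). -/
def vol : V4 [⋀^Fin 4]→ₗ[ℝ] ℝ := Matrix.detRowAlternating

/-- The four-bracket `⟨abcd⟩`. -/
def br (a b c d : V4) : ℝ := vol ![a, b, c, d]

/-- `Z_{i-1}`, where `Z_0 = -Z_4` (twisted cyclic labels for MHV data). The labels `1, 2, 3, 4`
are `0, 1, 2, 3 : Fin 4`. -/
def prv (Z : Fin 4 → V4) (i : Fin 4) : V4 := if i = 0 then -Z 3 else Z (i - 1)

/-- `Z_{i+1}`, where `Z_5 = -Z_1`. -/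
def nxt (Z : Fin 4 → V4) (i : Fin 4) : V4 := if i = 3 then -Z 0 else Z (i + 1)

/-- An oriented line `ℓ` enters only through its brackets `⟨ℓ X Y⟩` with two points; this is
the functional `⟨AB X Y⟩` of the line through the points `A` and `B`. -/
def joinLine (A B : V4) : V4 → V4 → ℝ := fun X Y => br A B X Y

/-- The functional `⟨(P ∩ Q) X Y⟩ = P(X) Q(Y) - P(Y) Q(X)` of the line in which the planes
with covectors `P` and `Q` meet. -/
def meetLine (P Q : V4) : V4 → V4 → ℝ := fun X Y => (P ⬝ᵥ X) * (Q ⬝ᵥ Y) - (P ⬝ᵥ Y) * (Q ⬝ᵥ X)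

/-- The bracket `⟨ℓ (abc) ∩ (def)⟩` of a line with the line in which two planes meet, where
`(abc) ∩ (def) = (ab)⟨cdef⟩ + (bc)⟨adef⟩ + (ca)⟨bdef⟩`. -/
def planeBracket (l : V4 → V4 → ℝ) (a b c d e f : V4) : ℝ :=
  l a b * br c d e f + l b c * br a d e f + l c a * br b d e f

/-- `⟨ℓ i̅ j̅⟩`, where `i̅` is the plane `(i-1 i i+1)`. -/
def barBracket (l : V4 → V4 → ℝ) (Z : Fin 4 → V4) (i j : Fin 4) : ℝ :=
  planeBracket l (prv Z i) (Z i) (nxt Z i) (prv Z j) (Z j) (nxt Z j)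

/-- The covector of the plane `i̅`: its pairing with `Y` is `⟨Y i-1 i i+1⟩`. -/
def dualData (Z : Fin 4 → V4) : Fin 4 → V4 :=
  fun i k => br (Pi.single k 1) (prv Z i) (Z i) (nxt Z i)

/-! ## The cut regions

A configuration is a pair `(A, B)` of representatives, with `A : V4` and `B : Fin L → V4`. -/

/-- The intersecting cut: `L` lines `A B_α` through a common point with `⟨A B_α i̅ j̅⟩ > 0`. -/
def intersectingCut (Z : Fin 4 → V4) (L : ℕ) : Set (V4 × (Fin L → V4)) :=
  {x | ∀ α, ∀ i j : Fin 4, i < j → 0 < barBracket (joinLine x.1 (x.2 α)) Z i j}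

/-- The coplanar cut: `L` lines `P ∩ Q_α` in a common plane `P` (all planes given by
covectors) with `⟨(P ∩ Q_α) i̅ j̅⟩ > 0`. -/
def coplanarCut (Z : Fin 4 → V4) (L : ℕ) : Set (V4 × (Fin L → V4)) :=
  {x | ∀ α, ∀ i j : Fin 4, i < j → 0 < barBracket (meetLine x.1 (x.2 α)) Z i j}

/-- The dual description of the coplanar cut: `L` lines `A B_α` through a common point with
`⟨A B_α i j⟩ > 0`. -/
def dualCoplanarCut (Z : Fin 4 → V4) (L : ℕ) : Set (V4 × (Fin L → V4)) :=
  {x | ∀ α, ∀ i j : Fin 4, i < j → 0 < br x.1 (x.2 α) (Z i) (Z j)}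

/-! ## Canonical forms of projective polytopes

`H` is a linear subspace of `V4` and `ω` an alternating form in `m + 1` variables. The
`m`-form `Ω(Y) ω(Y, dY, …, dY)` lives on the `m`-dimensional projective space of
`H / ker ω`; the measure `ω(Y, dY, …, dY)` is suppressed and also gives the orientation.
`C` is an open convex polyhedral cone in `H`.

* For `m = 0`, `C` is one of the two rays over a point and the form is `±1`, according to the
  orientation of the point.
* For `m + 1`, `C` is cut out of `H` by finitely many facet inequalities `ℓ_i > 0`. The form has
  at most simple poles, all on the facet hyperplanes, it is homogeneous of the degree that makes
  it a form on projective space, and its residue on each facet `ℓ_i = 0` is the canonical form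
  of that facet. With `ω = ℓ_i ∧ ω(u, …)`, where `ℓ_i(u) = 1`, the residue is the restriction
  of `ℓ_i Ω` to `ℓ_i = 0`. -/
def IsCanonicalFn :
    (m : ℕ) → Submodule ℝ V4 → (V4 [⋀^Fin (m + 1)]→ₗ[ℝ] ℝ) → Set V4 → (V4 → ℝ) → Prop
  | 0, H, ω, C, Ω =>
      C.Nonempty ∧ ∃ s : ℝ, (s = 1 ∨ s = -1) ∧ C = {Y | Y ∈ H ∧ 0 < s * ω ![Y]} ∧
        ∀ Y ∈ H, ω ![Y] ≠ 0 → Ω Y * ω ![Y] = s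
  | m + 1, H, ω, C, Ω =>
      C.Nonempty ∧ ∃ (N : ℕ) (l : Fin N → V4 →ₗ[ℝ] ℝ) (num : MvPolynomial (Fin 4) ℝ),
        C = {Y | Y ∈ H ∧ ∀ i, 0 < l i Y} ∧
        (∀ Y ∈ H, (∀ i, l i Y ≠ 0) → Ω Y * ∏ i, l i Y = MvPolynomial.eval Y num) ∧
        (∀ Y ∈ H, (∀ i, l i Y ≠ 0) → ∀ c : ℝ, c ≠ 0 → Ω (c • Y) * c ^ (m + 2) = Ω Y) ∧
        ∀ i, ∃ u ∈ H, l i u = 1 ∧ ∃ R : V4 → ℝ,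
          (∀ Y ∈ H, l i Y = 0 → (∀ j, j ≠ i → l j Y ≠ 0) →
            R Y * ∏ j ∈ Finset.univ.erase i, l j Y = MvPolynomial.eval Y num) ∧
          IsCanonicalFn m (H ⊓ LinearMap.ker (l i)) (ω.curryLeft u)
            {Y | Y ∈ H ∧ l i Y = 0 ∧ ∀ j, j ≠ i → 0 < l j Y} R

/-! ## Fibred cells and canonical forms of cut regions -/

/-- The data of a cell: a region `base` in `A`-space, over each `A` a region `fiber A` for every
single `B_α`, and rational functions `formA` and `formB` that accompany them. -/
structure Cell where
  base : Set V4
  fiber : V4 → Set V4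
  formA : V4 → ℝ
  formB : V4 → V4 → ℝ

/-- `base` is a polytope in projective three-space with canonical form `formA · ⟨A d³A⟩`; over
each of its points `fiber A` is a polygon in the projective plane of lines through `A`, with
canonical form `formB A · ⟨A B d²B⟩`; and `formB` is a rational function of `A` and `B`. -/
structure Cell.IsPositive (T : Cell) : Prop where
  base_form : IsCanonicalFn 3 ⊤ vol T.base T.formA
  fiber_form : ∀ A ∈ T.base, IsCanonicalFn 2 ⊤ (vol.curryLeft A) (T.fiber A) (T.formB A)
  fiber_shift : ∀ A ∈ T.base, ∀ B ∈ T.fiber A, ∀ c : ℝ, B + c • A ∈ T.fiber A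
  rational : ∃ p q : MvPolynomial (Fin 4 ⊕ Fin 4) ℝ, q ≠ 0 ∧ ∀ A B : V4,
    MvPolynomial.eval (Sum.elim A B) q ≠ 0 →
      T.formB A B * MvPolynomial.eval (Sum.elim A B) q = MvPolynomial.eval (Sum.elim A B) p

/-- The configurations of `L` lines in the cell. A configuration and its overall negative are
the same lines through the same point. -/
def Cell.points (T : Cell) (L : ℕ) : Set (V4 × (Fin L → V4)) :=
  {x | ∃ s : ℝ, (s = 1 ∨ s = -1) ∧ s • x.1 ∈ T.base ∧ ∀ α, s • x.2 α ∈ T.fiber (s • x.1)}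

/-- The canonical form of the cell at `L` loops: the form of the base times one copy of the form
of the fibre for each loop. -/
def Cell.form (T : Cell) {L : ℕ} (A : V4) (B : Fin L → V4) : ℝ :=
  T.formA A * ∏ α, T.formB A (B α)

/-- Coordinates of a configuration. -/
def coords {L : ℕ} (A : V4) (B : Fin L → V4) : Fin 4 ⊕ (Fin L × Fin 4) → ℝ :=
  Sum.elim A (fun p => B p.1 p.2)

/-- `R` is cut into the cells `T k`: they are pairwise disjoint subregions of `R`, and they
cover `R` up to a proper algebraic subset. -/
structure IsCellDecomposition {N L : ℕ} (R : Set (V4 × (Fin L → V4))) (T : Fin N → Cell) :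
    Prop where
  positive : ∀ k, (T k).IsPositive
  subset : ∀ k, (T k).points L ⊆ R
  disjoint : ∀ k k', k ≠ k' → Disjoint ((T k).points L) ((T k').points L)
  cover : ∃ q : MvPolynomial (Fin 4 ⊕ (Fin L × Fin 4)) ℝ, q ≠ 0 ∧ ∀ x ∈ R,
    MvPolynomial.eval (coords x.1 x.2) q ≠ 0 → ∃ k, x ∈ (T k).points L

/-- `Ω` (with the measure `⟨A d³A⟩ ∏_α ⟨A B_α d²B_α⟩` suppressed) is the canonical form of the
region `R`, oriented by `o = ±1` times that measure, evaluated at the representatives in `R`: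
it is, as a rational function, the sum of the canonical forms of the cells of a decomposition
of `R`. -/
def IsCanonicalForm {L : ℕ} (o : ℤˣ) (R : Set (V4 × (Fin L → V4)))
    (Ω : V4 → (Fin L → V4) → ℝ) : Prop :=
  ∃ (N : ℕ) (T : Fin N → Cell), IsCellDecomposition R T ∧
    ∃ q : MvPolynomial (Fin 4 ⊕ (Fin L × Fin 4)) ℝ, q ≠ 0 ∧ ∀ A B,
      MvPolynomial.eval (coords A B) q ≠ 0 → Ω A B = ((o : ℤ) : ℝ) * ∑ k, (T k).form A B

/-! ## The four-point data -/

/-- The form `[1234]` in `A`. -/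
def tetraForm (Z : Fin 4 → V4) (A : V4) : ℝ :=
  br (Z 0) (Z 1) (Z 2) (Z 3) ^ 3 /
    (br A (Z 0) (Z 1) (Z 2) * br A (Z 1) (Z 2) (Z 3) * br A (Z 2) (Z 3) (Z 0) *
      br A (Z 3) (Z 0) (Z 1))

/-- The form of the triangle with edges `(12), (23), (34)`. -/
def triForm1 (Z : Fin 4 → V4) (A B : V4) : ℝ :=
  br A (Z 0) (Z 1) (Z 2) * br A (Z 1) (Z 2) (Z 3) /
    (br A B (Z 0) (Z 1) * br A B (Z 1) (Z 2) * br A B (Z 2) (Z 3))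

/-- The form of the triangle with edges `(12), (23), (14)`. -/
def triForm2 (Z : Fin 4 → V4) (A B : V4) : ℝ :=
  (-1) * br A (Z 0) (Z 1) (Z 2) * br A (Z 0) (Z 1) (Z 3) /
    (br A B (Z 0) (Z 1) * br A B (Z 1) (Z 2) * br A B (Z 0) (Z 3))

/-- The form of the triangle with edges `(12), (34), (14)`. -/
def triForm3 (Z : Fin 4 → V4) (A B : V4) : ℝ :=
  (-1) * br A (Z 0) (Z 1) (Z 3) * br A (Z 0) (Z 2) (Z 3) /
    (br A B (Z 0) (Z 1) * br A B (Z 2) (Z 3) * br A B (Z 0) (Z 3))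

/-- The form of the triangle with edges `(23), (34), (14)`. -/
def triForm4 (Z : Fin 4 → V4) (A B : V4) : ℝ :=
  (-1) * br A (Z 0) (Z 2) (Z 3) * br A (Z 1) (Z 2) (Z 3) /
    (br A B (Z 1) (Z 2) * br A B (Z 2) (Z 3) * br A B (Z 0) (Z 3))

/-- The four-point form at `L` loops. -/
def fourPointForm (Z : Fin 4 → V4) {L : ℕ} (A : V4) (B : Fin L → V4) : ℝ :=
  tetraForm Z A *
    (∏ α, triForm1 Z A (B α) - ∏ α, triForm2 Z A (B α) +
      ∏ α, triForm3 Z A (B α) - ∏ α, triForm4 Z A (B α))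

/-- The open cone over the tetrahedron with vertices `ε_i Z_i`. -/
def tetra (Z : Fin 4 → V4) (ε : Fin 4 → ℝ) : Set V4 :=
  {A | ∃ t : Fin 4 → ℝ, (∀ i, 0 < t i) ∧ A = ∑ i, t i • ε i • Z i}

/-- The points `B` on the positive side of the lines `(ab), (cd), (ef)`, as seen from `A`. -/
def tri (a b c d e f : V4) (A : V4) : Set V4 :=
  {B | 0 < br A B a b ∧ 0 < br A B c d ∧ 0 < br A B e f}

/-- The four cells of the intersecting cut. -/
def interCell (Z : Fin 4 → V4) : Fin 4 → Cell :=
  ![{ base := tetra Z ![1, 1, -1, -1]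
      fiber := tri (Z 0) (Z 1) (Z 1) (Z 2) (Z 2) (Z 3)
      formA := tetraForm Z
      formB := triForm1 Z },
    { base := tetra Z ![1, -1, -1, -1]
      fiber := tri (Z 0) (Z 1) (Z 1) (Z 2) (Z 0) (Z 3)
      formA := fun A => -tetraForm Z A
      formB := triForm2 Z },
    { base := tetra Z ![1, 1, 1, 1]
      fiber := tri (Z 0) (Z 1) (Z 2) (Z 3) (Z 0) (Z 3)
      formA := tetraForm Z
      formB := triForm3 Z },
    { base := tetra Z ![1, 1, 1, -1]
      fiber := tri (Z 1) (Z 2) (Z 2) (Z 3) (Z 0) (Z 3)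
      formA := fun A => -tetraForm Z A
      formB := triForm4 Z }]

/-- The four cells of the dual coplanar cut. -/
def coplanarCell (Z : Fin 4 → V4) : Fin 4 → Cell :=
  ![{ base := tetra Z ![1, -1, -1, 1]
      fiber := tri (Z 0) (Z 1) (Z 1) (Z 2) (Z 2) (Z 3)
      formA := tetraForm Z
      formB := fun A B => -triForm1 Z A B },
    { base := tetra Z ![1, 1, -1, 1]
      fiber := tri (Z 0) (Z 1) (Z 1) (Z 2) (Z 0) (Z 3)
      formA := fun A => -tetraForm Z A
      formB := fun A B => -triForm2 Z A B },
    { base := tetra Z ![1, -1, 1, -1]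
      fiber := tri (Z 0) (Z 1) (Z 2) (Z 3) (Z 0) (Z 3)
      formA := tetraForm Z
      formB := fun A B => -triForm3 Z A B },
    { base := tetra Z ![1, -1, 1, 1]
      fiber := tri (Z 1) (Z 2) (Z 2) (Z 3) (Z 0) (Z 3)
      formA := fun A => -tetraForm Z A
      formB := fun A B => -triForm4 Z A B }]

end

end LoopCut

open LoopCut

namespace LoopCut

noncomputable section

/-! ## Canonical forms of simplices -/

/-! In the basis `Z` a line `AB` is a 2 × 4 matrix whose rows are the coordinates of `A` and `B`,
and both families of brackets become its minors. The plane of `i-1, i, i+1` is, up to sign, the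
coordinate plane opposite the remaining basis vector, so the intersecting cut says that all six
minors are positive (`mem_intersectingCut`). The dual coplanar cut says the same after permuting the
columns to 0, 3, 2, 1 and negating column 2 (`mem_dualCoplanarCut`).

If all minors are positive and the row of `A` starts with a positive entry, three-term Plücker
relations allow at most one sign change along that row (`TotPos.signs`): four tetrahedra for `A`.
For a fixed sign pattern the same relations deduce all six minors from three of them (the lemmas
`totPos_of_*`); these three are the edges of the triangle for every `B α`. As the pattern involves
only `A`, all loops share one triangle, and the decomposition does not depend on `L`.

Tetrahedra and triangles are simplices, whose form is a constant over the product of the facet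
functions, by induction on residues (`isCanonicalFn_simplex_of_dual`). The constant comes from
comparing determinants. The undualized coplanar cut reduces to the dual one for the covectors
`dualData Z`, whose four-bracket is again positive. -/

theorem isCanonicalFn_simplex_of_dual (m : ℕ) :
    ∀ (H : Submodule ℝ V4) (ω : V4 [⋀^Fin (m + 1)]→ₗ[ℝ] ℝ) (l : Fin (m + 1) → V4 →ₗ[ℝ] ℝ)
      (u : Fin (m + 1) → V4) (κ c : ℝ) (Ω : V4 → ℝ),
      (∀ i, u i ∈ H) → (∀ i j, l i (u j) = if i = j then 1 else 0) →
      (∀ Y : Fin (m + 1) → V4, (∀ i, Y i ∈ H) →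
        ω Y = κ * (Matrix.of fun i j => l i (Y j)).det) →
      c * |κ| = 1 →
      (∀ Y ∈ H, (∀ i, l i Y ≠ 0) → Ω Y * ∏ i, l i Y = c) →
      IsCanonicalFn m H ω {Y | Y ∈ H ∧ ∀ i, 0 < l i Y} Ω := by
  induction m with
  | zero =>
    intro H ω l u κ c Ω hu hlu hω hc hΩ
    have hκ : κ ≠ 0 := by rintro rfl; simp at hc
    have hωl : ∀ Y ∈ H, ω ![Y] = κ * l 0 Y := by
      intro Y hY
      rw [hω ![Y] (by simpa using hY)]
      simp
    -- The orientation of the point is the sign of `κ`.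
    refine ⟨⟨u 0, hu 0, by simp [hlu]⟩, κ / |κ|, ?_, ?_, ?_⟩
    · rcases lt_or_gt_of_ne hκ with h | h
      · right; rw [abs_of_neg h]; field_simp
      · left; rw [abs_of_pos h]; field_simp
    · ext Y
      refine and_congr_right fun hY => ?_
      have hpos : 0 < |κ| := abs_pos.2 hκ
      have : κ / |κ| * ω ![Y] = |κ| * l 0 Y := by
        rw [hωl Y hY]
        field_simp
        rw [sq_abs]
      rw [this]
      simp [Fin.forall_fin_one, hpos]
    · intro Y hY h
      have hl : l 0 Y ≠ 0 := by
        intro h0; rw [hωl Y hY, h0] at h; simp at h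
      have h1 : Ω Y * l 0 Y = c := by
        simpa using hΩ Y hY (by simpa [Fin.forall_fin_one] using hl)
      rw [hωl Y hY, eq_div_iff (abs_ne_zero.2 hκ)]
      linear_combination κ * |κ| * h1 + κ * hc
  | succ m ih =>
    intro H ω l u κ c Ω hu hlu hω hc hΩ
    refine ⟨⟨∑ j, u j, H.sum_mem fun j _ => hu j, fun i => by simp [hlu]⟩,
      m + 2, l, MvPolynomial.C c, rfl, ?_, ?_, ?_⟩
    · intro Y hY h
      rw [hΩ Y hY h, MvPolynomial.eval_C]
    · intro Y hY h t ht
      have h1 := hΩ Y hY h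
      have h2 := hΩ (t • Y) (H.smul_mem t hY) fun i => by simp [ht, h i]
      have hP : ∏ i, l i Y ≠ 0 := Finset.prod_ne_zero_iff.2 fun i _ => h i
      simp only [map_smul, smul_eq_mul, Finset.prod_mul_distrib, Finset.prod_const,
        Finset.card_univ, Fintype.card_fin] at h2
      apply mul_right_cancel₀ hP
      linear_combination h2 - h1
    · intro i
      have herase : ∀ Y, ∏ j ∈ Finset.univ.erase i, l j Y = ∏ k, l (i.succAbove k) Y := by
        intro Y
        rw [← Finset.compl_singleton, ← Fin.image_succAbove_univ,
          Finset.prod_image fun _ _ _ _ h => Fin.succAbove_right_injective h]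
      -- The residue keeps the constant `c` and loses only the factor `l i`. It is the form of a
      -- simplex of one dimension less inside `ker (l i)`, which is why the induction runs over
      -- subspaces `H`.
      refine ⟨u i, hu i, by simp [hlu], fun Y => c / ∏ k, l (i.succAbove k) Y, ?_, ?_⟩
      · intro Y hY hi hj
        rw [herase, MvPolynomial.eval_C]
        exact div_mul_cancel₀ _ (Finset.prod_ne_zero_iff.2 fun k _ => hj _ (i.succAbove_ne k))
      · have hC : {Y | Y ∈ H ∧ l i Y = 0 ∧ ∀ j, j ≠ i → 0 < l j Y} =
            {Y | Y ∈ H ⊓ LinearMap.ker (l i) ∧ ∀ k, 0 < l (i.succAbove k) Y} := by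
          ext Y
          simp only [Set.mem_ofPred_eq, Submodule.mem_inf, LinearMap.mem_ker, and_assoc]
          refine and_congr_right fun _ => and_congr_right fun _ =>
            ⟨fun h k => h _ (i.succAbove_ne k), fun h j hj => ?_⟩
          obtain ⟨k, rfl⟩ := Fin.exists_succAbove_eq hj
          exact h k
        rw [hC]
        -- Contracting with `u i` puts the `i`-th unit vector in the first column, so the expansion
        -- has one term, with sign `(-1) ^ i`. The normalization involves only `|κ|`, so `c`
        -- survives.
        refine ih _ _ _ (fun k => u (i.succAbove k)) (κ * (-1) ^ (i : ℕ)) c _ ?_ ?_ ?_ ?_ ?_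
        · intro k
          refine ⟨hu _, ?_⟩
          simp [hlu, (i.succAbove_ne k).symm]
        · intro j k
          simp [hlu]
        · intro Y hY
          rw [AlternatingMap.curryLeft_apply_apply, hω _ (by
            intro j
            refine Fin.cases (hu i) (fun k => (hY k).1) j), Matrix.det_succ_column_zero,
            Finset.sum_eq_single i]
          · simp only [Matrix.of_apply, Matrix.cons_val_zero, hlu, if_true, mul_one]
            rw [← mul_assoc]
            rfl
          · intro j _ hj
            simp [hlu, hj]
          · simp
        · rw [abs_mul, abs_pow, abs_neg, abs_one, one_pow, mul_one, hc]
        · intro Y _ hY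
          exact div_mul_cancel₀ _ (Finset.prod_ne_zero_iff.2 fun k _ => hY k)

theorem exists_dual_of_det_ne_zero {n : ℕ} (l : Fin n → V4 →ₗ[ℝ] ℝ) (Y : Fin n → V4)
    (h : (Matrix.of fun i j => l i (Y j)).det ≠ 0) :
    ∃ u : Fin n → V4, ∀ i j, l i (u j) = if i = j then 1 else 0 := by
  set M := Matrix.of fun i j => l i (Y j) with hM
  -- The columns of the inverse matrix give the dual vectors as combinations of the `Y k`.
  refine ⟨fun j => ∑ k, M⁻¹ k j • Y k, fun i j => ?_⟩
  have := congrFun (congrFun (Matrix.mul_nonsing_inv M (isUnit_iff_ne_zero.2 h)) i) j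
  rw [Matrix.mul_apply, Matrix.one_apply] at this
  rw [← this, map_sum]
  refine Finset.sum_congr rfl fun k _ => ?_
  rw [map_smul, smul_eq_mul, mul_comm]
  rfl

/-- A simplex cut out by `l i > 0` has the canonical form `c / ∏ i, l i`, where `c > 0` is fixed
by comparing the volume form with the determinant of the `l i`. -/
theorem isCanonicalFn_simplex {m : ℕ} (ω : V4 [⋀^Fin (m + 1)]→ₗ[ℝ] ℝ)
    (l : Fin (m + 1) → V4 →ₗ[ℝ] ℝ) (n : ℝ) (Ω : V4 → ℝ) (Y₀ : Fin (m + 1) → V4)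
    (hY₀ : ω Y₀ ≠ 0) (hn : n ≠ 0)
    (hω : ∀ Y, ω Y * n = (Matrix.of fun i j => l i (Y j)).det)
    (hΩ : ∀ Y, (∀ i, l i Y ≠ 0) → Ω Y * ∏ i, l i Y = |n|) :
    IsCanonicalFn m ⊤ ω {Y | ∀ i, 0 < l i Y} Ω := by
  obtain ⟨u, hu⟩ := exists_dual_of_det_ne_zero l Y₀ (by
    rw [← hω]; exact mul_ne_zero hY₀ hn)
  have := isCanonicalFn_simplex_of_dual m ⊤ ω l u n⁻¹ |n| Ω (fun _ => trivial) hu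
    (fun Y _ => by rw [← hω]; field_simp) (by rw [abs_inv]; field_simp)
    (fun Y _ => hΩ Y)
  simpa using this

/-! ## Brackets in the coordinates of a basis -/

theorem det_four (a b c d : Fin 4 → ℝ) : (Matrix.of ![a, b, c, d]).det =
    (a 0 * b 1 - a 1 * b 0) * (c 2 * d 3 - c 3 * d 2)
    - (a 0 * b 2 - a 2 * b 0) * (c 1 * d 3 - c 3 * d 1)
    + (a 0 * b 3 - a 3 * b 0) * (c 1 * d 2 - c 2 * d 1)
    + (a 1 * b 2 - a 2 * b 1) * (c 0 * d 3 - c 3 * d 0)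
    - (a 1 * b 3 - a 3 * b 1) * (c 0 * d 2 - c 2 * d 0)
    + (a 2 * b 3 - a 3 * b 2) * (c 0 * d 1 - c 1 * d 0) := by
  simp [Matrix.det_succ_row_zero, Fin.sum_univ_succ, Fin.succAbove]
  ring

theorem br_eq_det (a b c d : V4) : br a b c d = (Matrix.of ![a, b, c, d]).det := by
  unfold br vol Matrix.det
  congr 1

/-- The coordinate functions of the basis `Z`. -/
def crd (Z : Fin 4 → V4) (i : Fin 4) : V4 →ₗ[ℝ] ℝ :=
  (LinearMap.proj i).comp (Matrix.vecMulLinear (Matrix.of Z)⁻¹)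

theorem det_of_eq_br (Z : Fin 4 → V4) :
    (Matrix.of Z).det = br (Z 0) (Z 1) (Z 2) (Z 3) := by
  rw [br_eq_det]
  congr 2
  ext i j
  fin_cases i <;> rfl

section Basis

variable {Z : Fin 4 → V4} (hZ : br (Z 0) (Z 1) (Z 2) (Z 3) ≠ 0)
include hZ

theorem isUnit_det_of : IsUnit (Matrix.of Z).det := by
  rw [det_of_eq_br]; exact isUnit_iff_ne_zero.2 hZ

theorem crd_vecMul (Y : V4) : (fun i => crd Z i Y) ᵥ* Matrix.of Z = Y := by
  change (Y ᵥ* (Matrix.of Z)⁻¹) ᵥ* Matrix.of Z = Y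
  rw [Matrix.vecMul_vecMul, Matrix.nonsing_inv_mul _ (isUnit_det_of hZ), Matrix.vecMul_one]

theorem vecMul_crd (t : Fin 4 → ℝ) (i : Fin 4) : crd Z i (t ᵥ* Matrix.of Z) = t i := by
  change ((t ᵥ* Matrix.of Z) ᵥ* (Matrix.of Z)⁻¹) i = t i
  rw [Matrix.vecMul_vecMul, Matrix.mul_nonsing_inv _ (isUnit_det_of hZ), Matrix.vecMul_one]

theorem crd_basis (i j : Fin 4) : crd Z i (Z j) = if i = j then 1 else 0 := by
  have h : Z j = Pi.single j 1 ᵥ* Matrix.of Z := by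
    rw [Matrix.single_one_vecMul]; rfl
  rw [h, vecMul_crd hZ, Pi.single_apply]

theorem br_eq_crd (A B C E : V4) : br A B C E = br (Z 0) (Z 1) (Z 2) (Z 3) *
    (Matrix.of ![fun i => crd Z i A, fun i => crd Z i B, fun i => crd Z i C,
      fun i => crd Z i E]).det := by
  rw [← det_of_eq_br, mul_comm, ← Matrix.det_mul, br_eq_det]
  congr 1
  ext i j
  rw [Matrix.mul_apply_eq_vecMul]
  fin_cases i
  · exact (congrFun (crd_vecMul hZ A) j).symm
  · exact (congrFun (crd_vecMul hZ B) j).symm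
  · exact (congrFun (crd_vecMul hZ C) j).symm
  · exact (congrFun (crd_vecMul hZ E) j).symm

theorem br_edge01 {D : ℝ} (hD : br (Z 0) (Z 1) (Z 2) (Z 3) = D)
    (A B : V4) : br A B (Z 0) (Z 1) =
    D * (crd Z 2 A * crd Z 3 B - crd Z 3 A * crd Z 2 B) := by
  rw [br_eq_crd hZ, det_four, hD]; simp [crd_basis hZ]

theorem br_edge02 {D : ℝ} (hD : br (Z 0) (Z 1) (Z 2) (Z 3) = D)
    (A B : V4) : br A B (Z 0) (Z 2) =
    D * -(crd Z 1 A * crd Z 3 B - crd Z 3 A * crd Z 1 B) := by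
  rw [br_eq_crd hZ, det_four, hD]; simp [crd_basis hZ]

theorem br_edge03 {D : ℝ} (hD : br (Z 0) (Z 1) (Z 2) (Z 3) = D)
    (A B : V4) : br A B (Z 0) (Z 3) =
    D * (crd Z 1 A * crd Z 2 B - crd Z 2 A * crd Z 1 B) := by
  rw [br_eq_crd hZ, det_four, hD]; simp [crd_basis hZ]

theorem br_edge12 {D : ℝ} (hD : br (Z 0) (Z 1) (Z 2) (Z 3) = D)
    (A B : V4) : br A B (Z 1) (Z 2) =
    D * (crd Z 0 A * crd Z 3 B - crd Z 3 A * crd Z 0 B) := by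
  rw [br_eq_crd hZ, det_four, hD]; simp [crd_basis hZ]

theorem br_edge13 {D : ℝ} (hD : br (Z 0) (Z 1) (Z 2) (Z 3) = D)
    (A B : V4) : br A B (Z 1) (Z 3) =
    D * -(crd Z 0 A * crd Z 2 B - crd Z 2 A * crd Z 0 B) := by
  rw [br_eq_crd hZ, det_four, hD]; simp [crd_basis hZ]

theorem br_edge23 {D : ℝ} (hD : br (Z 0) (Z 1) (Z 2) (Z 3) = D)
    (A B : V4) : br A B (Z 2) (Z 3) =
    D * (crd Z 0 A * crd Z 1 B - crd Z 1 A * crd Z 0 B) := by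
  rw [br_eq_crd hZ, det_four, hD]; simp [crd_basis hZ]

theorem br_face012 {D : ℝ} (hD : br (Z 0) (Z 1) (Z 2) (Z 3) = D)
    (A : V4) : br A (Z 0) (Z 1) (Z 2) = D * -crd Z 3 A := by
  rw [br_eq_crd hZ, det_four, hD]; simp [crd_basis hZ]

theorem br_face123 {D : ℝ} (hD : br (Z 0) (Z 1) (Z 2) (Z 3) = D)
    (A : V4) : br A (Z 1) (Z 2) (Z 3) = D * crd Z 0 A := by
  rw [br_eq_crd hZ, det_four, hD]; simp [crd_basis hZ]

theorem br_face230 {D : ℝ} (hD : br (Z 0) (Z 1) (Z 2) (Z 3) = D)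
    (A : V4) : br A (Z 2) (Z 3) (Z 0) = D * -crd Z 1 A := by
  rw [br_eq_crd hZ, det_four, hD]; simp [crd_basis hZ]

theorem br_face301 {D : ℝ} (hD : br (Z 0) (Z 1) (Z 2) (Z 3) = D)
    (A : V4) : br A (Z 3) (Z 0) (Z 1) = D * crd Z 2 A := by
  rw [br_eq_crd hZ, det_four, hD]; simp [crd_basis hZ]

theorem br_face013 {D : ℝ} (hD : br (Z 0) (Z 1) (Z 2) (Z 3) = D)
    (A : V4) : br A (Z 0) (Z 1) (Z 3) = D * crd Z 2 A := by
  rw [br_eq_crd hZ, det_four, hD]; simp [crd_basis hZ]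

theorem br_face023 {D : ℝ} (hD : br (Z 0) (Z 1) (Z 2) (Z 3) = D)
    (A : V4) : br A (Z 0) (Z 2) (Z 3) = D * -crd Z 1 A := by
  rw [br_eq_crd hZ, det_four, hD]; simp [crd_basis hZ]

end Basis

/-! ## Tetrahedra -/

section Basis

variable {Z : Fin 4 → V4} (hZ : 0 < br (Z 0) (Z 1) (Z 2) (Z 3))
include hZ

theorem vol_eq_crd (Y : Fin 4 → V4) : vol Y = br (Z 0) (Z 1) (Z 2) (Z 3) *
    (Matrix.of fun i j => crd Z i (Y j)).det := by
  have h : vol Y = br (Y 0) (Y 1) (Y 2) (Y 3) := by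
    unfold br
    congr 1
    ext i j
    fin_cases i <;> rfl
  rw [h, br_eq_crd hZ.ne', ← Matrix.det_transpose]
  congr 2
  ext i j
  fin_cases j <;> rfl

theorem mem_tetra {ε : Fin 4 → ℝ} (hε : ∀ i, ε i = 1 ∨ ε i = -1) (A : V4) :
    A ∈ tetra Z ε ↔ ∀ i, 0 < ε i * crd Z i A := by
  have hsq : ∀ i, ε i * ε i = 1 := fun i => by rcases hε i with h | h <;> simp [h]
  constructor
  · rintro ⟨t, ht, rfl⟩ i
    have h : crd Z i (∑ j, t j • ε j • Z j) = t i * ε i := by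
      simp [map_sum, crd_basis hZ.ne']
    rw [h, mul_left_comm, hsq, mul_one]
    exact ht i
  · intro h
    refine ⟨_, h, ?_⟩
    conv_lhs => rw [← crd_vecMul hZ.ne' A]
    rw [Matrix.vecMul_eq_sum]
    refine Finset.sum_congr rfl fun i _ => ?_
    rw [smul_smul, mul_right_comm, hsq, one_mul]
    rfl

/-- The four face brackets are plus or minus `D` times the coordinates of `A`; the two minus signs
cancel. -/
theorem tetraForm_eq (A : V4) : tetraForm Z A = (br (Z 0) (Z 1) (Z 2) (Z 3))⁻¹ /
    ∏ i, crd Z i A := by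
  have := hZ.ne'
  obtain ⟨D, hD⟩ : ∃ D, br (Z 0) (Z 1) (Z 2) (Z 3) = D := ⟨_, rfl⟩
  rw [tetraForm, hD, br_face012 this hD, br_face123 this hD, br_face230 this hD,
    br_face301 this hD, Fin.prod_univ_four, inv_eq_one_div, div_div]
  rw [hD] at this
  rw [show ∀ a b c d : ℝ, D * -d * (D * a) * (D * -b) * (D * c) = D ^ 3 * (D * (a * b * c * d))
      from fun _ _ _ _ => by ring]
  nth_rewrite 1 [← mul_one (D ^ 3)]
  exact mul_div_mul_left _ _ (pow_ne_zero 3 this)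

/-- Negating a vertex negates one facet function, hence the product in the denominator, while the
constant stays positive. This is the source of the alternating signs in front of `[1234]`. -/
theorem isCanonicalFn_tetra {ε : Fin 4 → ℝ} (hε : ∀ i, ε i = 1 ∨ ε i = -1) :
    IsCanonicalFn 3 ⊤ vol (tetra Z ε) (fun A => (∏ i, ε i) * tetraForm Z A) := by
  set D := br (Z 0) (Z 1) (Z 2) (Z 3) with hD
  have habs : |∏ i, ε i| = 1 := by
    rw [Finset.abs_prod]
    refine Finset.prod_eq_one fun i _ => ?_
    rcases hε i with h | h <;> simp [h]
  have hset : tetra Z ε = {Y | ∀ i, 0 < (ε i • crd Z i) Y} := by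
    ext A
    simp [mem_tetra hZ hε]
  have hne : ∏ i, ε i ≠ 0 := by
    intro h; simp [h] at habs
  rw [hset]
  refine isCanonicalFn_simplex vol (fun i => ε i • crd Z i) ((∏ i, ε i) * D⁻¹) _ Z ?_ ?_ ?_ ?_
  · rw [vol_eq_crd hZ]
    have h1 : (Matrix.of fun i j => crd Z i (Z j)) = 1 := by
      ext i j
      simp [crd_basis hZ.ne', Matrix.one_apply]
    rw [h1, Matrix.det_one, mul_one]
    exact hZ.ne'
  · exact mul_ne_zero hne (inv_ne_zero hZ.ne')
  · intro Y
    rw [vol_eq_crd hZ]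
    have h1 := Matrix.det_mul_column ε (Matrix.of fun i j => crd Z i (Y j))
    simp only [LinearMap.smul_apply, smul_eq_mul, Matrix.of_apply] at h1 ⊢
    rw [h1, ← hD]
    have := hZ.ne'
    field_simp
  · intro Y hY
    rw [abs_mul, habs, one_mul, abs_of_pos (inv_pos.2 hZ), tetraForm_eq hZ]
    have hY' : ∀ i, crd Z i Y ≠ 0 := fun i h => hY i (by simp [h])
    have hP : ∏ i, crd Z i Y ≠ 0 := Finset.prod_ne_zero_iff.2 fun i _ => hY' i
    simp only [LinearMap.smul_apply, smul_eq_mul, Finset.prod_mul_distrib]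
    have hs : (∏ i, ε i) * ∏ i, ε i = 1 := by
      rw [← Finset.prod_mul_distrib]
      refine Finset.prod_eq_one fun i _ => ?_
      rcases hε i with h | h <;> simp [h]
    rw [← hD]
    field_simp
    rw [sq, hs]

end Basis

/-! ## Triangles -/

/-- The bracket `⟨A B X Y⟩` as a linear function of `B`. -/
def brLinear (A X Y : V4) : V4 →ₗ[ℝ] ℝ where
  toFun B := br A B X Y
  map_add' B C := by
    simp only [br_eq_det, det_four, Pi.add_apply]
    ring
  map_smul' c B := by
    simp only [br_eq_det, det_four, Pi.smul_apply, smul_eq_mul, RingHom.id_apply]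
    ring

/-- The determinant of the three edge functions of a triangle. -/
def edgeDet (A a b c d e f : V4) (Y : Fin 3 → V4) : ℝ :=
  (Matrix.of fun i j : Fin 3 =>
    ![br A (Y j) a b, br A (Y j) c d, br A (Y j) e f] i).det

theorem isCanonicalFn_tri {A a b c d e f X₁ X₂ X₃ : V4} (hA : br A X₁ X₂ X₃ ≠ 0) {τ n : ℝ}
    (hτ : |τ| = 1) (hn : 0 < n)
    (hdet : ∀ Y, br A (Y 0) (Y 1) (Y 2) * (τ * n) = edgeDet A a b c d e f Y) :
    IsCanonicalFn 2 ⊤ (vol.curryLeft A) (tri a b c d e f A)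
      (fun B => n / (br A B a b * br A B c d * br A B e f)) := by
  have hset : tri a b c d e f A =
      {B | ∀ i, 0 < (![brLinear A a b, brLinear A c d, brLinear A e f] i) B} := by
    ext B
    simp [tri, Fin.forall_fin_succ, brLinear]
  have hcurry : ∀ Y : Fin 3 → V4, vol.curryLeft A Y = br A (Y 0) (Y 1) (Y 2) := by
    intro Y
    rw [AlternatingMap.curryLeft_apply_apply, br]
    congr 1
    ext i j
    fin_cases i <;> rfl
  rw [hset]
  refine isCanonicalFn_simplex _ _ (τ * n) _ ![X₁, X₂, X₃] ?_ ?_ ?_ ?_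
  · rw [hcurry]; simpa using hA
  · refine mul_ne_zero ?_ hn.ne'
    rintro rfl; simp at hτ
  · intro Y
    rw [hcurry, hdet, edgeDet]
    congr 2
    ext i j
    fin_cases i <;> rfl
  · intro B hB
    have h0 := hB 0
    have h1 := hB 1
    have h2 := hB 2
    rw [abs_mul, hτ, one_mul, abs_of_pos hn, Fin.prod_univ_three]
    exact div_mul_cancel₀ _ (mul_ne_zero (mul_ne_zero h0 h1) h2)

/-- Polynomial functions of `A` and `B`. -/
def IsPolyFn (f : V4 → V4 → ℝ) : Prop :=
  ∃ p : MvPolynomial (Fin 4 ⊕ Fin 4) ℝ, ∀ A B, MvPolynomial.eval (Sum.elim A B) p = f A B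

theorem IsPolyFn.mul {f g : V4 → V4 → ℝ} (hf : IsPolyFn f) (hg : IsPolyFn g) :
    IsPolyFn fun A B => f A B * g A B := by
  obtain ⟨p, hp⟩ := hf
  obtain ⟨q, hq⟩ := hg
  exact ⟨p * q, fun A B => by rw [map_mul, hp, hq]⟩

theorem IsPolyFn.neg {f : V4 → V4 → ℝ} (hf : IsPolyFn f) : IsPolyFn fun A B => -f A B := by
  obtain ⟨p, hp⟩ := hf
  exact ⟨-p, fun A B => by rw [map_neg, hp]⟩

theorem isPolyFn_br {f : V4 → V4 → Fin 4 → V4}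
    (hf : ∀ i j, IsPolyFn fun A B => f A B i j) :
    IsPolyFn fun A B => br (f A B 0) (f A B 1) (f A B 2) (f A B 3) := by
  choose p hp using hf
  refine ⟨(Matrix.of p).det, fun A B => ?_⟩
  rw [RingHom.map_det]
  refine Eq.trans ?_ (det_of_eq_br (f A B))
  congr 1
  ext i j
  exact hp i j A B

theorem isPolyFn_fst (j : Fin 4) : IsPolyFn fun A _ => A j :=
  ⟨MvPolynomial.X (Sum.inl j), fun A B => by simp⟩

theorem isPolyFn_snd (j : Fin 4) : IsPolyFn fun _ B => B j :=
  ⟨MvPolynomial.X (Sum.inr j), fun A B => by simp⟩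

theorem isPolyFn_const (c : ℝ) : IsPolyFn fun _ _ => c :=
  ⟨MvPolynomial.C c, fun A B => by simp⟩

theorem isPolyFn_edge (X Y : V4) : IsPolyFn fun A B => br A B X Y := by
  refine isPolyFn_br (f := fun A B => ![A, B, X, Y]) fun i j => ?_
  fin_cases i
  exacts [isPolyFn_fst j, isPolyFn_snd j, isPolyFn_const (X j), isPolyFn_const (Y j)]

theorem isPolyFn_face (X Y W : V4) : IsPolyFn fun A _ => br A X Y W := by
  refine isPolyFn_br (f := fun A _ => ![A, X, Y, W]) fun i j => ?_
  fin_cases i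
  exacts [isPolyFn_fst j, isPolyFn_const (X j), isPolyFn_const (Y j), isPolyFn_const (W j)]

theorem IsCanonicalFn.nonempty {m : ℕ} {H : Submodule ℝ V4} {ω : V4 [⋀^Fin (m + 1)]→ₗ[ℝ] ℝ}
    {C : Set V4} {Ω : V4 → ℝ} (h : IsCanonicalFn m H ω C Ω) : C.Nonempty := by
  cases m <;> exact h.1

theorem br_add_smul (A B X Y : V4) (c : ℝ) : br A (B + c • A) X Y = br A B X Y := by
  simp only [br_eq_det, det_four, Pi.add_apply, Pi.smul_apply, smul_eq_mul]
  ring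

/-- A family of triangles with fixed edges over a polytope. -/
theorem isPositive_tri {T : Cell} {a b c d e f X₁ X₂ X₃ : V4} {num : V4 → ℝ} {τ : ℝ}
    (hbase : IsCanonicalFn 3 ⊤ vol T.base T.formA) (hfiber : T.fiber = tri a b c d e f)
    (hform : ∀ A B, T.formB A B = num A / (br A B a b * br A B c d * br A B e f))
    (hpoly : IsPolyFn fun A _ => num A) (hnum : ∀ A ∈ T.base, 0 < num A)
    (hA : ∀ A ∈ T.base, br A X₁ X₂ X₃ ≠ 0) (hτ : |τ| = 1)
    (hdet : ∀ A Y, br A (Y 0) (Y 1) (Y 2) * (τ * num A) = edgeDet A a b c d e f Y) :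
    T.IsPositive := by
  have hfib : ∀ A ∈ T.base, IsCanonicalFn 2 ⊤ (vol.curryLeft A) (T.fiber A) (T.formB A) := by
    intro A h
    rw [hfiber, funext (hform A)]
    exact isCanonicalFn_tri (hA A h) hτ (hnum A h) (hdet A)
  refine ⟨hbase, hfib, ?_, ?_⟩
  · intro A _ B hB t
    rw [hfiber] at hB ⊢
    simpa [tri, br_add_smul] using hB
  · obtain ⟨p, hp⟩ := hpoly
    obtain ⟨q, hq⟩ := ((isPolyFn_edge a b).mul (isPolyFn_edge c d)).mul (isPolyFn_edge e f)
    refine ⟨p, q, ?_, ?_⟩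
    -- The denominator is positive at any point of a nonempty fibre, so it is not the zero
    -- polynomial.
    · rintro rfl
      obtain ⟨A, hA'⟩ := hbase.nonempty
      obtain ⟨B, hB⟩ := (hfib A hA').nonempty
      rw [hfiber] at hB
      obtain ⟨h1, h2, h3⟩ := hB
      have := hq A B
      rw [map_zero] at this
      exact (mul_pos (mul_pos h1 h2) h3).ne this
    · intro A B h
      rw [hp, hform, hq]
      rw [hq] at h
      exact div_mul_cancel₀ _ h

/-! ### Edge determinants of the four triangles -/

section Basis

variable {Z : Fin 4 → V4} (hZ : 0 < br (Z 0) (Z 1) (Z 2) (Z 3))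
include hZ

/-- Three functionals of `B` that vanish at `A` have determinant proportional to `⟨A Y₀ Y₁ Y₂⟩`. The
factor is quadratic in `A` and vanishes when `A` lies in the plane of two edges that share some `Z
i`, since these two functionals are then proportional. Here, and in the next three lemmas, there are
two such pairs of edges, hence two face brackets. -/
theorem edgeDet_tri1 (A : V4) (Y : Fin 3 → V4) :
    br A (Y 0) (Y 1) (Y 2) * (br A (Z 0) (Z 1) (Z 2) * br A (Z 1) (Z 2) (Z 3)) =
      edgeDet A (Z 0) (Z 1) (Z 1) (Z 2) (Z 2) (Z 3) Y := by
  have h := hZ.ne'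
  obtain ⟨D, hD⟩ : ∃ D, br (Z 0) (Z 1) (Z 2) (Z 3) = D := ⟨_, rfl⟩
  rw [br_face012 h hD, br_face123 h hD, edgeDet, Matrix.det_fin_three]
  simp only [Matrix.of_apply, Matrix.cons_val, br_edge01 h hD, br_edge12 h hD, br_edge23 h hD]
  rw [br_eq_crd h, det_four, hD]
  ring

theorem edgeDet_tri2 (A : V4) (Y : Fin 3 → V4) :
    br A (Y 0) (Y 1) (Y 2) * -(br A (Z 0) (Z 1) (Z 2) * br A (Z 0) (Z 1) (Z 3)) =
      edgeDet A (Z 0) (Z 1) (Z 1) (Z 2) (Z 0) (Z 3) Y := by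
  have h := hZ.ne'
  obtain ⟨D, hD⟩ : ∃ D, br (Z 0) (Z 1) (Z 2) (Z 3) = D := ⟨_, rfl⟩
  rw [br_face012 h hD, br_face013 h hD, edgeDet, Matrix.det_fin_three]
  simp only [Matrix.of_apply, Matrix.cons_val, br_edge01 h hD, br_edge12 h hD, br_edge03 h hD]
  rw [br_eq_crd h, det_four, hD]
  ring

theorem edgeDet_tri3 (A : V4) (Y : Fin 3 → V4) :
    br A (Y 0) (Y 1) (Y 2) * -(br A (Z 0) (Z 1) (Z 3) * br A (Z 0) (Z 2) (Z 3)) =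
      edgeDet A (Z 0) (Z 1) (Z 2) (Z 3) (Z 0) (Z 3) Y := by
  have h := hZ.ne'
  obtain ⟨D, hD⟩ : ∃ D, br (Z 0) (Z 1) (Z 2) (Z 3) = D := ⟨_, rfl⟩
  rw [br_face013 h hD, br_face023 h hD, edgeDet, Matrix.det_fin_three]
  simp only [Matrix.of_apply, Matrix.cons_val, br_edge01 h hD, br_edge23 h hD, br_edge03 h hD]
  rw [br_eq_crd h, det_four, hD]
  ring

theorem edgeDet_tri4 (A : V4) (Y : Fin 3 → V4) :
    br A (Y 0) (Y 1) (Y 2) * -(br A (Z 0) (Z 2) (Z 3) * br A (Z 1) (Z 2) (Z 3)) =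
      edgeDet A (Z 1) (Z 2) (Z 2) (Z 3) (Z 0) (Z 3) Y := by
  have h := hZ.ne'
  obtain ⟨D, hD⟩ : ∃ D, br (Z 0) (Z 1) (Z 2) (Z 3) = D := ⟨_, rfl⟩
  rw [br_face023 h hD, br_face123 h hD, edgeDet, Matrix.det_fin_three]
  simp only [Matrix.of_apply, Matrix.cons_val, br_edge12 h hD, br_edge23 h hD, br_edge03 h hD]
  rw [br_eq_crd h, det_four, hD]
  ring

end Basis

/-! ## The cells are positive -/

section Basis

variable {Z : Fin 4 → V4} (hZ : 0 < br (Z 0) (Z 1) (Z 2) (Z 3))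
include hZ

theorem tetra_base {e₀ e₁ e₂ e₃ σ : ℝ} {f : V4 → ℝ}
    (he : ∀ i, (![e₀, e₁, e₂, e₃] : Fin 4 → ℝ) i = 1 ∨ (![e₀, e₁, e₂, e₃] : Fin 4 → ℝ) i = -1)
    (hσ : e₀ * e₁ * e₂ * e₃ = σ) (hf : ∀ A, f A = σ * tetraForm Z A) :
    IsCanonicalFn 3 ⊤ vol (tetra Z ![e₀, e₁, e₂, e₃]) f := by
  have h := isCanonicalFn_tetra hZ he
  rw [Fin.prod_univ_four] at h
  simp only [Matrix.cons_val] at h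
  rw [hσ] at h
  rwa [funext hf]

theorem mem_tetra_four {e₀ e₁ e₂ e₃ : ℝ}
    (he : ∀ i, (![e₀, e₁, e₂, e₃] : Fin 4 → ℝ) i = 1 ∨ (![e₀, e₁, e₂, e₃] : Fin 4 → ℝ) i = -1)
    (A : V4) : A ∈ tetra Z ![e₀, e₁, e₂, e₃] ↔
      0 < e₀ * crd Z 0 A ∧ 0 < e₁ * crd Z 1 A ∧ 0 < e₂ * crd Z 2 A ∧ 0 < e₃ * crd Z 3 A := by
  rw [mem_tetra hZ he]
  simp [Fin.forall_fin_succ]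

theorem mem_base_inter0 (A : V4) : A ∈ (interCell Z 0).base ↔
    0 < crd Z 0 A ∧ 0 < crd Z 1 A ∧ crd Z 2 A < 0 ∧ crd Z 3 A < 0 := by
  refine (mem_tetra_four hZ (by simp [Fin.forall_fin_succ]) A).trans ?_
  simp

theorem mem_base_inter1 (A : V4) : A ∈ (interCell Z 1).base ↔
    0 < crd Z 0 A ∧ crd Z 1 A < 0 ∧ crd Z 2 A < 0 ∧ crd Z 3 A < 0 := by
  refine (mem_tetra_four hZ (by simp [Fin.forall_fin_succ]) A).trans ?_
  simp

theorem mem_base_inter2 (A : V4) : A ∈ (interCell Z 2).base ↔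
    0 < crd Z 0 A ∧ 0 < crd Z 1 A ∧ 0 < crd Z 2 A ∧ 0 < crd Z 3 A := by
  refine (mem_tetra_four hZ (by simp [Fin.forall_fin_succ]) A).trans ?_
  simp

theorem mem_base_inter3 (A : V4) : A ∈ (interCell Z 3).base ↔
    0 < crd Z 0 A ∧ 0 < crd Z 1 A ∧ 0 < crd Z 2 A ∧ crd Z 3 A < 0 := by
  refine (mem_tetra_four hZ (by simp [Fin.forall_fin_succ]) A).trans ?_
  simp

theorem mem_base_coplanar0 (A : V4) : A ∈ (coplanarCell Z 0).base ↔
    0 < crd Z 0 A ∧ crd Z 1 A < 0 ∧ crd Z 2 A < 0 ∧ 0 < crd Z 3 A := by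
  refine (mem_tetra_four hZ (by simp [Fin.forall_fin_succ]) A).trans ?_
  simp

theorem mem_base_coplanar1 (A : V4) : A ∈ (coplanarCell Z 1).base ↔
    0 < crd Z 0 A ∧ 0 < crd Z 1 A ∧ crd Z 2 A < 0 ∧ 0 < crd Z 3 A := by
  refine (mem_tetra_four hZ (by simp [Fin.forall_fin_succ]) A).trans ?_
  simp

theorem mem_base_coplanar2 (A : V4) : A ∈ (coplanarCell Z 2).base ↔
    0 < crd Z 0 A ∧ crd Z 1 A < 0 ∧ 0 < crd Z 2 A ∧ crd Z 3 A < 0 := by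
  refine (mem_tetra_four hZ (by simp [Fin.forall_fin_succ]) A).trans ?_
  simp

theorem mem_base_coplanar3 (A : V4) : A ∈ (coplanarCell Z 3).base ↔
    0 < crd Z 0 A ∧ crd Z 1 A < 0 ∧ 0 < crd Z 2 A ∧ 0 < crd Z 3 A := by
  refine (mem_tetra_four hZ (by simp [Fin.forall_fin_succ]) A).trans ?_
  simp

/-- All eight bases have first sign `+`, so this one bracket shows for each of them that the form
`vol.curryLeft A` on the fibre is nonzero. -/
theorem br_face_ne_zero {A : V4} (h : 0 < crd Z 0 A) : br A (Z 1) (Z 2) (Z 3) ≠ 0 := by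
  rw [br_face123 hZ.ne' rfl]
  exact mul_ne_zero hZ.ne' h.ne'

theorem interCell_isPositive (k : Fin 4) : (interCell Z k).IsPositive := by
  obtain ⟨D, hD⟩ : ∃ D, br (Z 0) (Z 1) (Z 2) (Z 3) = D := ⟨_, rfl⟩
  have hD0 : 0 < D := hD ▸ hZ
  have hD2 := mul_pos hD0 hD0
  have hZ' := hZ.ne'
  fin_cases k
  · refine isPositive_tri (T := interCell Z 0) (τ := 1) (X₁ := Z 1) (X₂ := Z 2) (X₃ := Z 3)
      (num := fun A => br A (Z 0) (Z 1) (Z 2) * br A (Z 1) (Z 2) (Z 3))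
      (tetra_base hZ (by simp [Fin.forall_fin_succ]) rfl fun A => ?_) rfl (fun A B => rfl)
      ((isPolyFn_face _ _ _).mul (isPolyFn_face _ _ _)) (fun A hA => ?_)
      (fun A hA => br_face_ne_zero hZ ((mem_base_inter0 hZ A).1 hA).1) (by norm_num)
      fun A Y => ?_
    · change tetraForm Z A = _
      ring
    · obtain ⟨h0, h1, h2, h3⟩ := (mem_base_inter0 hZ A).1 hA
      rw [br_face012 hZ' hD, br_face123 hZ' hD]
      linarith [mul_pos hD2 (mul_pos h0 (neg_pos.2 h3))]
    · rw [← edgeDet_tri1 hZ]; ring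
  · refine isPositive_tri (T := interCell Z 1) (τ := 1) (X₁ := Z 1) (X₂ := Z 2) (X₃ := Z 3)
      (num := fun A => -(br A (Z 0) (Z 1) (Z 2) * br A (Z 0) (Z 1) (Z 3)))
      (tetra_base hZ (by simp [Fin.forall_fin_succ]) rfl fun A => ?_) rfl (fun A B => ?_)
      ((isPolyFn_face _ _ _).mul (isPolyFn_face _ _ _)).neg (fun A hA => ?_)
      (fun A hA => br_face_ne_zero hZ ((mem_base_inter1 hZ A).1 hA).1) (by norm_num)
      fun A Y => ?_
    · change -tetraForm Z A = _
      ring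
    · change triForm2 Z A B = _
      rw [triForm2]; ring
    · obtain ⟨h0, h1, h2, h3⟩ := (mem_base_inter1 hZ A).1 hA
      rw [br_face012 hZ' hD, br_face013 hZ' hD]
      linarith [mul_pos hD2 (mul_pos_of_neg_of_neg h2 h3)]
    · rw [← edgeDet_tri2 hZ]; ring
  · refine isPositive_tri (T := interCell Z 2) (τ := 1) (X₁ := Z 1) (X₂ := Z 2) (X₃ := Z 3)
      (num := fun A => -(br A (Z 0) (Z 1) (Z 3) * br A (Z 0) (Z 2) (Z 3)))
      (tetra_base hZ (by simp [Fin.forall_fin_succ]) rfl fun A => ?_) rfl (fun A B => ?_)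
      ((isPolyFn_face _ _ _).mul (isPolyFn_face _ _ _)).neg (fun A hA => ?_)
      (fun A hA => br_face_ne_zero hZ ((mem_base_inter2 hZ A).1 hA).1) (by norm_num)
      fun A Y => ?_
    · change tetraForm Z A = _
      ring
    · change triForm3 Z A B = _
      rw [triForm3]; ring
    · obtain ⟨h0, h1, h2, h3⟩ := (mem_base_inter2 hZ A).1 hA
      rw [br_face013 hZ' hD, br_face023 hZ' hD]
      linarith [mul_pos hD2 (mul_pos h1 h2)]
    · rw [← edgeDet_tri3 hZ]; ring
  · refine isPositive_tri (T := interCell Z 3) (τ := 1) (X₁ := Z 1) (X₂ := Z 2) (X₃ := Z 3)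
      (num := fun A => -(br A (Z 0) (Z 2) (Z 3) * br A (Z 1) (Z 2) (Z 3)))
      (tetra_base hZ (by simp [Fin.forall_fin_succ]) rfl fun A => ?_) rfl (fun A B => ?_)
      ((isPolyFn_face _ _ _).mul (isPolyFn_face _ _ _)).neg (fun A hA => ?_)
      (fun A hA => br_face_ne_zero hZ ((mem_base_inter3 hZ A).1 hA).1) (by norm_num)
      fun A Y => ?_
    · change -tetraForm Z A = _
      ring
    · change triForm4 Z A B = _
      rw [triForm4]; ring
    · obtain ⟨h0, h1, h2, h3⟩ := (mem_base_inter3 hZ A).1 hA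
      rw [br_face023 hZ' hD, br_face123 hZ' hD]
      linarith [mul_pos hD2 (mul_pos h0 h1)]
    · rw [← edgeDet_tri4 hZ]; ring

/-- Over these tetrahedra the numerators of the `T_k` are negative. The positive numerator is their
negative, and the edges are oppositely oriented, whence `τ = -1`. -/
theorem coplanarCell_isPositive (k : Fin 4) : (coplanarCell Z k).IsPositive := by
  obtain ⟨D, hD⟩ : ∃ D, br (Z 0) (Z 1) (Z 2) (Z 3) = D := ⟨_, rfl⟩
  have hD0 : 0 < D := hD ▸ hZ
  have hD2 := mul_pos hD0 hD0
  have hZ' := hZ.ne'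
  fin_cases k
  · refine isPositive_tri (T := coplanarCell Z 0) (τ := -1) (X₁ := Z 1) (X₂ := Z 2) (X₃ := Z 3)
      (num := fun A => -(br A (Z 0) (Z 1) (Z 2) * br A (Z 1) (Z 2) (Z 3)))
      (tetra_base hZ (by simp [Fin.forall_fin_succ]) rfl fun A => ?_) rfl (fun A B => ?_)
      ((isPolyFn_face _ _ _).mul (isPolyFn_face _ _ _)).neg (fun A hA => ?_)
      (fun A hA => br_face_ne_zero hZ ((mem_base_coplanar0 hZ A).1 hA).1) (by norm_num)
      fun A Y => ?_
    · change tetraForm Z A = _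
      ring
    · change -triForm1 Z A B = _
      rw [triForm1]; ring
    · obtain ⟨h0, h1, h2, h3⟩ := (mem_base_coplanar0 hZ A).1 hA
      rw [br_face012 hZ' hD, br_face123 hZ' hD]
      linarith [mul_pos hD2 (mul_pos h0 h3)]
    · rw [← edgeDet_tri1 hZ]; ring
  · refine isPositive_tri (T := coplanarCell Z 1) (τ := -1) (X₁ := Z 1) (X₂ := Z 2) (X₃ := Z 3)
      (num := fun A => br A (Z 0) (Z 1) (Z 2) * br A (Z 0) (Z 1) (Z 3))
      (tetra_base hZ (by simp [Fin.forall_fin_succ]) rfl fun A => ?_) rfl (fun A B => ?_)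
      ((isPolyFn_face _ _ _).mul (isPolyFn_face _ _ _)) (fun A hA => ?_)
      (fun A hA => br_face_ne_zero hZ ((mem_base_coplanar1 hZ A).1 hA).1) (by norm_num)
      fun A Y => ?_
    · change -tetraForm Z A = _
      ring
    · change -triForm2 Z A B = _
      rw [triForm2]; ring
    · obtain ⟨h0, h1, h2, h3⟩ := (mem_base_coplanar1 hZ A).1 hA
      rw [br_face012 hZ' hD, br_face013 hZ' hD]
      linarith [mul_pos hD2 (mul_pos (neg_pos.2 h2) h3)]
    · rw [← edgeDet_tri2 hZ]; ring
  · refine isPositive_tri (T := coplanarCell Z 2) (τ := -1) (X₁ := Z 1) (X₂ := Z 2) (X₃ := Z 3)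
      (num := fun A => br A (Z 0) (Z 1) (Z 3) * br A (Z 0) (Z 2) (Z 3))
      (tetra_base hZ (by simp [Fin.forall_fin_succ]) rfl fun A => ?_) rfl (fun A B => ?_)
      ((isPolyFn_face _ _ _).mul (isPolyFn_face _ _ _)) (fun A hA => ?_)
      (fun A hA => br_face_ne_zero hZ ((mem_base_coplanar2 hZ A).1 hA).1) (by norm_num)
      fun A Y => ?_
    · change tetraForm Z A = _
      ring
    · change -triForm3 Z A B = _
      rw [triForm3]; ring
    · obtain ⟨h0, h1, h2, h3⟩ := (mem_base_coplanar2 hZ A).1 hA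
      rw [br_face013 hZ' hD, br_face023 hZ' hD]
      linarith [mul_pos hD2 (mul_pos (neg_pos.2 h1) h2)]
    · rw [← edgeDet_tri3 hZ]; ring
  · refine isPositive_tri (T := coplanarCell Z 3) (τ := -1) (X₁ := Z 1) (X₂ := Z 2) (X₃ := Z 3)
      (num := fun A => br A (Z 0) (Z 2) (Z 3) * br A (Z 1) (Z 2) (Z 3))
      (tetra_base hZ (by simp [Fin.forall_fin_succ]) rfl fun A => ?_) rfl (fun A B => ?_)
      ((isPolyFn_face _ _ _).mul (isPolyFn_face _ _ _)) (fun A hA => ?_)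
      (fun A hA => br_face_ne_zero hZ ((mem_base_coplanar3 hZ A).1 hA).1) (by norm_num)
      fun A Y => ?_
    · change -tetraForm Z A = _
      ring
    · change -triForm4 Z A B = _
      rw [triForm4]; ring
    · obtain ⟨h0, h1, h2, h3⟩ := (mem_base_coplanar3 hZ A).1 hA
      rw [br_face023 hZ' hD, br_face123 hZ' hD]
      linarith [mul_pos hD2 (mul_pos h0 (neg_pos.2 h1))]
    · rw [← edgeDet_tri4 hZ]; ring

/-! ## Decompositions -/

/-- Cells over tetrahedra `± tetra Z (E k)` that differ in more than an overall sign. -/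
theorem isCellDecomposition_of_tetra {L : ℕ} {R : Set (V4 × (Fin L → V4))} {T : Fin 4 → Cell}
    {E : Fin 4 → Fin 4 → ℝ} (hE : ∀ k i, E k i = 1 ∨ E k i = -1)
    (hbase : ∀ k, (T k).base = tetra Z (E k))
    (hdist : ∀ k k', k ≠ k' → (∃ i, E k i * E k' i < 0) ∧ ∃ i, 0 < E k i * E k' i)
    (hneg : ∀ A B, (A, B) ∈ R → (-A, -B) ∈ R) (hpos : ∀ k, (T k).IsPositive)
    (hsub : ∀ k A B, A ∈ (T k).base → (∀ α, B α ∈ (T k).fiber A) → (A, B) ∈ R)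
    (hcov : ∀ A B, (A, B) ∈ R → (∀ i, crd Z i A ≠ 0) → 0 < crd Z 0 A →
      ∃ k, A ∈ (T k).base ∧ ∀ α, B α ∈ (T k).fiber A) :
    IsCellDecomposition R T := by
  have hZ' := hZ.ne'
  refine ⟨hpos, ?_, ?_, ?_⟩
  · rintro k ⟨A, B⟩ ⟨s, rfl | rfl, hA, hB⟩
    · simp only [one_smul] at hA hB
      exact hsub k A B hA hB
    · simp only [neg_smul, one_smul] at hA hB
      simpa using hneg _ _ (hsub k (-A) (-B) hA hB)
  · intro k k' hk
    rw [Set.disjoint_left]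
    rintro ⟨A, B⟩ ⟨s, hs, hA, -⟩ ⟨s', hs', hA', -⟩
    rw [hbase, mem_tetra hZ (hE _)] at hA hA'
    simp only [map_smul, smul_eq_mul] at hA hA'
    obtain ⟨⟨i, hi⟩, ⟨j, hj⟩⟩ := hdist k k' hk
    -- A common point would make the two sign patterns agree up to the overall sign `s * s'`. An
    -- index of agreement forces this sign to be `+`, and an index of disagreement then gives the
    -- contradiction.
    have key : ∀ i, 0 < E k i * E k' i * (s * s') := by
      intro i
      have h := mul_pos (hA i) (hA' i)
      rw [show E k i * (s * crd Z i A) * (E k' i * (s' * crd Z i A)) =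
        E k i * E k' i * (s * s') * (crd Z i A * crd Z i A) by ring] at h
      exact pos_of_mul_pos_left h (mul_self_nonneg _)
    have h1 := pos_of_mul_pos_right (key j) hj.le
    exact absurd (key i) (not_lt.2 (mul_nonpos_of_nonpos_of_nonneg hi.le h1.le))
  · have hpoly : ∀ i, ∃ p : MvPolynomial (Fin 4 ⊕ (Fin L × Fin 4)) ℝ, ∀ (A : V4)
        (B : Fin L → V4), MvPolynomial.eval (coords A B) p = crd Z i A := by
      intro i
      refine ⟨∑ j, MvPolynomial.X (Sum.inl j) *
        MvPolynomial.C ((Matrix.of Z)⁻¹ j i), fun A B => ?_⟩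
      rw [map_sum]
      change _ = ∑ j, A j * (Matrix.of Z)⁻¹ j i
      refine Finset.sum_congr rfl fun j _ => ?_
      rw [map_mul, MvPolynomial.eval_X, MvPolynomial.eval_C]
      rfl
    choose p hp using hpoly
    -- The excluded set is where `A` lies on one of the four coordinate planes.
    refine ⟨∏ i, p i, ?_, ?_⟩
    · refine Finset.prod_ne_zero_iff.2 fun i _ h => ?_
      have := hp i (Z i) 0
      rw [h, map_zero, crd_basis hZ'] at this
      simp at this
    · rintro ⟨A, B⟩ hx hq
      have hA : ∀ i, crd Z i A ≠ 0 := by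
        intro i
        rw [map_prod] at hq
        rw [← hp i A B]
        exact Finset.prod_ne_zero_iff.1 hq i (Finset.mem_univ i)
      rcases lt_or_gt_of_ne (hA 0) with h | h
      · obtain ⟨k, h1, h2⟩ := hcov (-A) (-B) (hneg A B hx) (fun i => by simpa using hA i)
          (by simpa using h)
        exact ⟨k, -1, Or.inr rfl, by simpa using h1, fun α => by simpa using h2 α⟩
      · obtain ⟨k, h1, h2⟩ := hcov A B hx hA h
        exact ⟨k, 1, Or.inl rfl, by simpa using h1, fun α => by simpa using h2 α⟩

end Basis

/-! ## Total positivity of `2 × 4` matrices -/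

/-- All minors of the matrix with rows `a` and `b` are positive. -/
def TotPos (a₀ a₁ a₂ a₃ b₀ b₁ b₂ b₃ : ℝ) : Prop :=
  0 < a₀ * b₁ - a₁ * b₀ ∧ 0 < a₀ * b₂ - a₂ * b₀ ∧ 0 < a₀ * b₃ - a₃ * b₀ ∧
    0 < a₁ * b₂ - a₂ * b₁ ∧ 0 < a₁ * b₃ - a₃ * b₁ ∧ 0 < a₂ * b₃ - a₃ * b₂

/-- The shape in which the relation `aᵢ mⱼₖ - aⱼ mᵢₖ + aₖ mᵢⱼ = 0` between entries and minors is
used: solved for one product, with both others made positive. -/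
theorem pos_of_mul_eq_add {a p x y z w : ℝ} (ha : 0 < a) (hx : 0 < x) (hy : 0 < y) (hz : 0 < z)
    (hw : 0 < w) (h : a * p = x * y + z * w) : 0 < p :=
  pos_of_mul_pos_right (h ▸ add_pos (mul_pos hx hy) (mul_pos hz hw)) ha.le

section

variable {a₀ a₁ a₂ a₃ b₀ b₁ b₂ b₃ : ℝ}

/-- The letters in this and the next three names are the signs of the row `a`; the three given
minors are the edges of the triangle over that tetrahedron. -/
theorem totPos_of_ppnn (h0 : 0 < a₀) (h1 : 0 < a₁) (h2 : a₂ < 0) (h3 : a₃ < 0)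
    (h01 : 0 < a₀ * b₁ - a₁ * b₀) (h03 : 0 < a₀ * b₃ - a₃ * b₀)
    (h23 : 0 < a₂ * b₃ - a₃ * b₂) : TotPos a₀ a₁ a₂ a₃ b₀ b₁ b₂ b₃ := by
  have h02 : 0 < a₀ * b₂ - a₂ * b₀ :=
    pos_of_mul_eq_add (neg_pos.2 h3) h0 h23 (neg_pos.2 h2) h03 (by ring)
  exact ⟨h01, h02, h03, pos_of_mul_eq_add h0 h1 h02 (neg_pos.2 h2) h01 (by ring),
    pos_of_mul_eq_add h0 h1 h03 (neg_pos.2 h3) h01 (by ring), h23⟩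

theorem totPos_of_pnnn (h0 : 0 < a₀) (h1 : a₁ < 0) (h2 : a₂ < 0) (h3 : a₃ < 0)
    (h03 : 0 < a₀ * b₃ - a₃ * b₀) (h12 : 0 < a₁ * b₂ - a₂ * b₁)
    (h23 : 0 < a₂ * b₃ - a₃ * b₂) : TotPos a₀ a₁ a₂ a₃ b₀ b₁ b₂ b₃ := by
  have h02 : 0 < a₀ * b₂ - a₂ * b₀ :=
    pos_of_mul_eq_add (neg_pos.2 h3) h0 h23 (neg_pos.2 h2) h03 (by ring)
  exact ⟨pos_of_mul_eq_add (neg_pos.2 h2) h0 h12 (neg_pos.2 h1) h02 (by ring), h02, h03, h12,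
    pos_of_mul_eq_add (neg_pos.2 h2) (neg_pos.2 h1) h23 (neg_pos.2 h3) h12 (by ring), h23⟩

theorem totPos_of_pppp (h0 : 0 < a₀) (h1 : 0 < a₁) (h2 : 0 < a₂) (h3 : 0 < a₃)
    (h01 : 0 < a₀ * b₁ - a₁ * b₀) (h12 : 0 < a₁ * b₂ - a₂ * b₁)
    (h23 : 0 < a₂ * b₃ - a₃ * b₂) : TotPos a₀ a₁ a₂ a₃ b₀ b₁ b₂ b₃ := by
  have h02 : 0 < a₀ * b₂ - a₂ * b₀ := pos_of_mul_eq_add h1 h0 h12 h2 h01 (by ring)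
  exact ⟨h01, h02, pos_of_mul_eq_add h2 h0 h23 h3 h02 (by ring), h12,
    pos_of_mul_eq_add h2 h1 h23 h3 h12 (by ring), h23⟩

theorem totPos_of_pppn (h0 : 0 < a₀) (h1 : 0 < a₁) (h2 : 0 < a₂) (h3 : a₃ < 0)
    (h01 : 0 < a₀ * b₁ - a₁ * b₀) (h03 : 0 < a₀ * b₃ - a₃ * b₀)
    (h12 : 0 < a₁ * b₂ - a₂ * b₁) : TotPos a₀ a₁ a₂ a₃ b₀ b₁ b₂ b₃ := by
  have h02 : 0 < a₀ * b₂ - a₂ * b₀ := pos_of_mul_eq_add h1 h0 h12 h2 h01 (by ring)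
  exact ⟨h01, h02, h03, h12, pos_of_mul_eq_add h0 h1 h03 (neg_pos.2 h3) h01 (by ring),
    pos_of_mul_eq_add h0 h2 h03 (neg_pos.2 h3) h02 (by ring)⟩

/-- The signs in a row of a totally positive matrix change at most once. -/
theorem TotPos.signs (h : TotPos a₀ a₁ a₂ a₃ b₀ b₁ b₂ b₃) (h0 : 0 < a₀) (h1 : a₁ ≠ 0)
    (h2 : a₂ ≠ 0) (h3 : a₃ ≠ 0) :
    (0 < a₁ ∧ a₂ < 0 ∧ a₃ < 0) ∨ (a₁ < 0 ∧ a₂ < 0 ∧ a₃ < 0) ∨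
      (0 < a₁ ∧ 0 < a₂ ∧ 0 < a₃) ∨ (0 < a₁ ∧ 0 < a₂ ∧ a₃ < 0) := by
  obtain ⟨h01, h02, h03, h12, h13, h23⟩ := h
  -- The three-term relation is now solved for an entry of `a`, with a minor as coefficient: `m₀₂ a₁
  -- = a₀ m₁₂ + a₂ m₀₁`. A positive entry thus forces those to its left to be positive.
  have k2 : 0 < a₂ → 0 < a₁ := fun h2 => pos_of_mul_eq_add h02 h0 h12 h2 h01 (by ring)
  have k3 : 0 < a₃ → 0 < a₁ := fun h3 => pos_of_mul_eq_add h03 h0 h13 h3 h01 (by ring)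
  have k4 : 0 < a₃ → 0 < a₂ := fun h3 => pos_of_mul_eq_add h03 h0 h23 h3 h02 (by ring)
  rcases lt_or_gt_of_ne h1 with h1 | h1 <;> rcases lt_or_gt_of_ne h2 with h2 | h2 <;>
    rcases lt_or_gt_of_ne h3 with h3 | h3
  · tauto
  · exact absurd (k3 h3) h1.not_gt
  · exact absurd (k2 h2) h1.not_gt
  · exact absurd (k3 h3) h1.not_gt
  · tauto
  · exact absurd (k4 h3) h2.not_gt
  · tauto
  · tauto

end

/-! ## Membership in the cuts and the fibres -/

section Basis

variable {Z : Fin 4 → V4} (hZ : 0 < br (Z 0) (Z 1) (Z 2) (Z 3))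
include hZ

/-- Bracketing with two basis vectors leaves the complementary minor, negated for the pairs 0, 2 and
1, 3. -/
theorem edge_pos_iff (A B : V4) :
    (0 < br A B (Z 0) (Z 1) ↔ 0 < crd Z 2 A * crd Z 3 B - crd Z 3 A * crd Z 2 B) ∧
    (0 < br A B (Z 0) (Z 2) ↔ 0 < -(crd Z 1 A * crd Z 3 B - crd Z 3 A * crd Z 1 B)) ∧
    (0 < br A B (Z 0) (Z 3) ↔ 0 < crd Z 1 A * crd Z 2 B - crd Z 2 A * crd Z 1 B) ∧
    (0 < br A B (Z 1) (Z 2) ↔ 0 < crd Z 0 A * crd Z 3 B - crd Z 3 A * crd Z 0 B) ∧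
    (0 < br A B (Z 1) (Z 3) ↔ 0 < -(crd Z 0 A * crd Z 2 B - crd Z 2 A * crd Z 0 B)) ∧
    (0 < br A B (Z 2) (Z 3) ↔ 0 < crd Z 0 A * crd Z 1 B - crd Z 1 A * crd Z 0 B) := by
  obtain ⟨D, hD⟩ : ∃ D, br (Z 0) (Z 1) (Z 2) (Z 3) = D := ⟨_, rfl⟩
  have h := hZ.ne'
  rw [br_edge01 h hD, br_edge02 h hD, br_edge03 h hD, br_edge12 h hD, br_edge13 h hD,
    br_edge23 h hD]
  rw [hD] at hZ
  exact ⟨mul_pos_iff_of_pos_left hZ, mul_pos_iff_of_pos_left hZ, mul_pos_iff_of_pos_left hZ,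
    mul_pos_iff_of_pos_left hZ, mul_pos_iff_of_pos_left hZ, mul_pos_iff_of_pos_left hZ⟩

/-- Reordering the columns as 0, 3, 2, 1 and negating column 2 absorbs the two minus signs of
`edge_pos_iff`. -/
theorem mem_dualCoplanarCut {L : ℕ} (A : V4) (B : Fin L → V4) :
    (A, B) ∈ dualCoplanarCut Z L ↔ ∀ α,
      TotPos (crd Z 0 A) (crd Z 3 A) (-crd Z 2 A) (crd Z 1 A)
        (crd Z 0 (B α)) (crd Z 3 (B α)) (-crd Z 2 (B α)) (crd Z 1 (B α)) := by
  refine forall_congr' fun α => ?_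
  obtain ⟨e01, e02, e03, e12, e13, e23⟩ := edge_pos_iff hZ A (B α)
  constructor
  · intro h
    have h01 := e01.1 (h 0 1 (by decide))
    have h02 := e02.1 (h 0 2 (by decide))
    have h03 := e03.1 (h 0 3 (by decide))
    have h12 := e12.1 (h 1 2 (by decide))
    have h13 := e13.1 (h 1 3 (by decide))
    have h23 := e23.1 (h 2 3 (by decide))
    refine ⟨?_, ?_, ?_, ?_, ?_, ?_⟩ <;> linarith
  · rintro ⟨h12, h13, h23, h01, h02, h03⟩ i j hij
    have k01 := e01.2 (by linarith)
    have k02 := e02.2 (by linarith)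
    have k03 := e03.2 (by linarith)
    have k12 := e12.2 (by linarith)
    have k13 := e13.2 (by linarith)
    have k23 := e23.2 (by linarith)
    fin_cases i <;> fin_cases j <;> first | exact absurd hij (by decide) | assumption

/-- The plane of `i` misses only the basis vector with index `i + 2` mod 4, so the bracket of planes
`i` and `j` is plus or minus `D²` times the minor in columns `i + 2` and `j + 2`. The twisted labels
make each a positive multiple of the minor with increasing columns. -/
theorem barBracket_joinLine (A B : V4) :
    0 < barBracket (joinLine A B) Z 0 1 ∧ 0 < barBracket (joinLine A B) Z 0 2 ∧
    0 < barBracket (joinLine A B) Z 0 3 ∧ 0 < barBracket (joinLine A B) Z 1 2 ∧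
    0 < barBracket (joinLine A B) Z 1 3 ∧ 0 < barBracket (joinLine A B) Z 2 3 ↔
    TotPos (crd Z 0 A) (crd Z 1 A) (crd Z 2 A) (crd Z 3 A)
      (crd Z 0 B) (crd Z 1 B) (crd Z 2 B) (crd Z 3 B) := by
  obtain ⟨D, hD⟩ : ∃ D, br (Z 0) (Z 1) (Z 2) (Z 3) = D := ⟨_, rfl⟩
  have h := hZ.ne'
  have hD2 : 0 < D * D := mul_self_pos.2 (hD ▸ h)
  have hbr : ∀ A B C E, br A B C E = D * (Matrix.of ![fun i => crd Z i A, fun i => crd Z i B,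
      fun i => crd Z i C, fun i => crd Z i E]).det := by
    intro A B C E
    rw [br_eq_crd h, hD]
  have p0 : prv Z 0 = -Z 3 := rfl
  have p1 : prv Z 1 = Z 0 := rfl
  have p2 : prv Z 2 = Z 1 := rfl
  have p3 : prv Z 3 = Z 2 := rfl
  have n0 : nxt Z 0 = Z 1 := rfl
  have n1 : nxt Z 1 = Z 2 := rfl
  have n2 : nxt Z 2 = Z 3 := rfl
  have n3 : nxt Z 3 = -Z 0 := rfl
  have e01 : barBracket (joinLine A B) Z 0 1 =
      D * D * (crd Z 2 A * crd Z 3 B - crd Z 3 A * crd Z 2 B) := by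
    simp only [barBracket, planeBracket, joinLine, p0, p1, n0, n1, hbr, det_four, map_neg]
    simp [crd_basis h]
    ring
  have e02 : barBracket (joinLine A B) Z 0 2 =
      D * D * (crd Z 0 A * crd Z 2 B - crd Z 2 A * crd Z 0 B) := by
    simp only [barBracket, planeBracket, joinLine, p0, p2, n0, n2, hbr, det_four, map_neg]
    simp [crd_basis h]
    ring
  have e03 : barBracket (joinLine A B) Z 0 3 =
      D * D * (crd Z 1 A * crd Z 2 B - crd Z 2 A * crd Z 1 B) := by
    simp only [barBracket, planeBracket, joinLine, p0, p3, n0, n3, hbr, det_four, map_neg]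
    simp [crd_basis h]
    ring
  have e12 : barBracket (joinLine A B) Z 1 2 =
      D * D * (crd Z 0 A * crd Z 3 B - crd Z 3 A * crd Z 0 B) := by
    simp only [barBracket, planeBracket, joinLine, p1, p2, n1, n2, hbr, det_four]
    simp [crd_basis h]
    ring
  have e13 : barBracket (joinLine A B) Z 1 3 =
      D * D * (crd Z 1 A * crd Z 3 B - crd Z 3 A * crd Z 1 B) := by
    simp only [barBracket, planeBracket, joinLine, p1, p3, n1, n3, hbr, det_four, map_neg]
    simp [crd_basis h]
    ring
  have e23 : barBracket (joinLine A B) Z 2 3 =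
      D * D * (crd Z 0 A * crd Z 1 B - crd Z 1 A * crd Z 0 B) := by
    simp only [barBracket, planeBracket, joinLine, p2, p3, n2, n3, hbr, det_four, map_neg]
    simp [crd_basis h]
    ring
  rw [e01, e02, e03, e12, e13, e23]
  simp only [mul_pos_iff_of_pos_left hD2, TotPos]
  tauto

theorem mem_intersectingCut {L : ℕ} (A : V4) (B : Fin L → V4) :
    (A, B) ∈ intersectingCut Z L ↔ ∀ α,
      TotPos (crd Z 0 A) (crd Z 1 A) (crd Z 2 A) (crd Z 3 A)
        (crd Z 0 (B α)) (crd Z 1 (B α)) (crd Z 2 (B α)) (crd Z 3 (B α)) := by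
  refine forall_congr' fun α => ?_
  rw [← barBracket_joinLine hZ]
  constructor
  · intro h
    exact ⟨h 0 1 (by decide), h 0 2 (by decide), h 0 3 (by decide), h 1 2 (by decide),
      h 1 3 (by decide), h 2 3 (by decide)⟩
  · rintro ⟨h01, h02, h03, h12, h13, h23⟩ i j hij
    fin_cases i <;> fin_cases j <;> first | exact absurd hij (by decide) | assumption

/-! ## The cell decompositions -/

theorem isCellDecomposition_intersectingCut {L : ℕ} (hL : 1 ≤ L) :
    IsCellDecomposition (intersectingCut Z L) (interCell Z) := by
  refine isCellDecomposition_of_tetra hZ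
    (E := ![![1, 1, -1, -1], ![1, -1, -1, -1], ![1, 1, 1, 1], ![1, 1, 1, -1]]) ?_ ?_ ?_ ?_
    (interCell_isPositive hZ) ?_ ?_
  · simp [Fin.forall_fin_succ]
  · intro k; fin_cases k <;> rfl
  · simp [Fin.forall_fin_succ, Fin.exists_fin_succ]
  · intro A B h
    rw [mem_intersectingCut hZ] at h ⊢
    simpa [TotPos] using h
  · intro k A B hA hB
    rw [mem_intersectingCut hZ]
    intro α
    obtain ⟨e01, -, e03, e12, -, e23⟩ := edge_pos_iff hZ A (B α)
    fin_cases k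
    · obtain ⟨h0, h1, h2, h3⟩ := (mem_base_inter0 hZ A).1 hA
      obtain ⟨k01, k12, k23⟩ := hB α
      exact totPos_of_ppnn h0 h1 h2 h3 (e23.1 k23) (e12.1 k12) (e01.1 k01)
    · obtain ⟨h0, h1, h2, h3⟩ := (mem_base_inter1 hZ A).1 hA
      obtain ⟨k01, k12, k03⟩ := hB α
      exact totPos_of_pnnn h0 h1 h2 h3 (e12.1 k12) (e03.1 k03) (e01.1 k01)
    · obtain ⟨h0, h1, h2, h3⟩ := (mem_base_inter2 hZ A).1 hA
      obtain ⟨k01, k23, k03⟩ := hB α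
      exact totPos_of_pppp h0 h1 h2 h3 (e23.1 k23) (e03.1 k03) (e01.1 k01)
    · obtain ⟨h0, h1, h2, h3⟩ := (mem_base_inter3 hZ A).1 hA
      obtain ⟨k12, k23, k03⟩ := hB α
      exact totPos_of_pppn h0 h1 h2 h3 (e23.1 k23) (e12.1 k12) (e03.1 k03)
  · intro A B h hA h0
    rw [mem_intersectingCut hZ] at h
    have e := fun α => edge_pos_iff hZ A (B α)
    -- One loop, available since `1 ≤ L`, fixes the sign pattern of `A` and with it the cell for all
    -- loops.
    rcases (h ⟨0, hL⟩).signs h0 (hA 1) (hA 2) (hA 3) with h' | h' | h' | h'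
    · exact ⟨0, (mem_base_inter0 hZ A).2 ⟨h0, h'⟩, fun α =>
        ⟨(e α).1.2 (h α).2.2.2.2.2, (e α).2.2.2.1.2 (h α).2.2.1, (e α).2.2.2.2.2.2 (h α).1⟩⟩
    · exact ⟨1, (mem_base_inter1 hZ A).2 ⟨h0, h'⟩, fun α =>
        ⟨(e α).1.2 (h α).2.2.2.2.2, (e α).2.2.2.1.2 (h α).2.2.1, (e α).2.2.1.2 (h α).2.2.2.1⟩⟩
    · exact ⟨2, (mem_base_inter2 hZ A).2 ⟨h0, h'⟩, fun α =>
        ⟨(e α).1.2 (h α).2.2.2.2.2, (e α).2.2.2.2.2.2 (h α).1, (e α).2.2.1.2 (h α).2.2.2.1⟩⟩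
    · exact ⟨3, (mem_base_inter3 hZ A).2 ⟨h0, h'⟩, fun α =>
        ⟨(e α).2.2.2.1.2 (h α).2.2.1, (e α).2.2.2.2.2.2 (h α).1, (e α).2.2.1.2 (h α).2.2.2.1⟩⟩

theorem isCellDecomposition_dualCoplanarCut {L : ℕ} (hL : 1 ≤ L) :
    IsCellDecomposition (dualCoplanarCut Z L) (coplanarCell Z) := by
  refine isCellDecomposition_of_tetra hZ
    (E := ![![1, -1, -1, 1], ![1, 1, -1, 1], ![1, -1, 1, -1], ![1, -1, 1, 1]]) ?_ ?_ ?_ ?_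
    (coplanarCell_isPositive hZ) ?_ ?_
  · simp [Fin.forall_fin_succ]
  · intro k; fin_cases k <;> rfl
  · simp [Fin.forall_fin_succ, Fin.exists_fin_succ]
  · intro A B h
    rw [mem_dualCoplanarCut hZ] at h ⊢
    simpa [TotPos] using h
  · intro k A B hA hB
    rw [mem_dualCoplanarCut hZ]
    intro α
    obtain ⟨e01, -, e03, e12, -, e23⟩ := edge_pos_iff hZ A (B α)
    fin_cases k
    · obtain ⟨h0, h1, h2, h3⟩ := (mem_base_coplanar0 hZ A).1 hA
      obtain ⟨k01, k12, k23⟩ := hB α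
      rw [e01] at k01
      exact totPos_of_pppn h0 h3 (neg_pos.2 h2) h1 (e12.1 k12) (e23.1 k23) (by linarith)
    · obtain ⟨h0, h1, h2, h3⟩ := (mem_base_coplanar1 hZ A).1 hA
      obtain ⟨k01, k12, k03⟩ := hB α
      rw [e01] at k01
      rw [e03] at k03
      exact totPos_of_pppp h0 h3 (neg_pos.2 h2) h1 (e12.1 k12) (by linarith) (by linarith)
    · obtain ⟨h0, h1, h2, h3⟩ := (mem_base_coplanar2 hZ A).1 hA
      obtain ⟨k01, k23, k03⟩ := hB α
      rw [e01] at k01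
      rw [e03] at k03
      exact totPos_of_pnnn h0 h3 (neg_neg_iff_pos.2 h2) h1 (e23.1 k23) (by linarith)
        (by linarith)
    · obtain ⟨h0, h1, h2, h3⟩ := (mem_base_coplanar3 hZ A).1 hA
      obtain ⟨k12, k23, k03⟩ := hB α
      rw [e03] at k03
      exact totPos_of_ppnn h0 h3 (neg_neg_iff_pos.2 h2) h1 (e12.1 k12) (e23.1 k23)
        (by linarith)
  · intro A B h hA h0
    have hsign := ((mem_dualCoplanarCut hZ A B).1 h ⟨0, hL⟩).signs h0 (hA 3)
      (neg_ne_zero.2 (hA 2)) (hA 1)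
    have k01 := fun α => h α 0 1 (by decide)
    have k03 := fun α => h α 0 3 (by decide)
    have k12 := fun α => h α 1 2 (by decide)
    have k23 := fun α => h α 2 3 (by decide)
    -- The patterns refer to the columns 0, 3, -2, 1, so they meet the cells in reverse order.
    rcases hsign with ⟨h3, h2, h1⟩ | ⟨h3, h2, h1⟩ | ⟨h3, h2, h1⟩ | ⟨h3, h2, h1⟩
    · exact ⟨3, (mem_base_coplanar3 hZ A).2 ⟨h0, h1, neg_neg_iff_pos.1 h2, h3⟩,
        fun α => ⟨k12 α, k23 α, k03 α⟩⟩
    · exact ⟨2, (mem_base_coplanar2 hZ A).2 ⟨h0, h1, neg_neg_iff_pos.1 h2, h3⟩,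
        fun α => ⟨k01 α, k23 α, k03 α⟩⟩
    · exact ⟨1, (mem_base_coplanar1 hZ A).2 ⟨h0, h1, neg_pos.1 h2, h3⟩,
        fun α => ⟨k01 α, k12 α, k03 α⟩⟩
    · exact ⟨0, (mem_base_coplanar0 hZ A).2 ⟨h0, h1, neg_pos.1 h2, h3⟩,
        fun α => ⟨k01 α, k12 α, k23 α⟩⟩

end Basis

/-! ## The forms -/

theorem fourPointForm_eq_sum_inter (Z : Fin 4 → V4) {L : ℕ} (A : V4) (B : Fin L → V4) :
    fourPointForm Z A B = ∑ k, (interCell Z k).form A B := by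
  rw [Fin.sum_univ_four]
  change _ = tetraForm Z A * ∏ α, triForm1 Z A (B α) + -tetraForm Z A * ∏ α, triForm2 Z A (B α) +
    tetraForm Z A * ∏ α, triForm3 Z A (B α) + -tetraForm Z A * ∏ α, triForm4 Z A (B α)
  rw [fourPointForm]
  ring

/-- The base forms are those of the intersecting cells, and each of the `L` triangle factors is
negated. -/
theorem fourPointForm_eq_sum_coplanar (Z : Fin 4 → V4) {L : ℕ} (A : V4) (B : Fin L → V4) :
    fourPointForm Z A B = (-1 : ℝ) ^ L * ∑ k, (coplanarCell Z k).form A B := by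
  have hneg : ∀ f : Fin L → ℝ, ∏ α, -f α = (-1) ^ L * ∏ α, f α := by
    intro f
    rw [Finset.prod_neg, Finset.card_univ, Fintype.card_fin]
  rw [Fin.sum_univ_four]
  change _ = _ * (tetraForm Z A * ∏ α, -triForm1 Z A (B α) +
    -tetraForm Z A * ∏ α, -triForm2 Z A (B α) +
    tetraForm Z A * ∏ α, -triForm3 Z A (B α) + -tetraForm Z A * ∏ α, -triForm4 Z A (B α))
  rw [hneg, hneg, hneg, hneg, fourPointForm]
  have hsq : ((-1 : ℝ) ^ L) * (-1) ^ L = 1 := by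
    rw [← mul_pow]; simp
  linear_combination (-tetraForm Z A *
    (∏ α, triForm1 Z A (B α) - ∏ α, triForm2 Z A (B α) +
      ∏ α, triForm3 Z A (B α) - ∏ α, triForm4 Z A (B α))) * hsq

theorem isCanonicalForm_intersectingCut {Z : Fin 4 → V4}
    (hZ : 0 < br (Z 0) (Z 1) (Z 2) (Z 3)) {L : ℕ} (hL : 1 ≤ L) :
    IsCanonicalForm 1 (intersectingCut Z L) (fourPointForm Z) :=
  ⟨4, interCell Z, isCellDecomposition_intersectingCut hZ hL, 1, one_ne_zero, fun A B _ => by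
    simpa using fourPointForm_eq_sum_inter Z A B⟩

theorem isCanonicalForm_dualCoplanarCut {Z : Fin 4 → V4}
    (hZ : 0 < br (Z 0) (Z 1) (Z 2) (Z 3)) {L : ℕ} (hL : 1 ≤ L) :
    IsCanonicalForm ((-1) ^ L) (dualCoplanarCut Z L) (fourPointForm Z) :=
  ⟨4, coplanarCell Z, isCellDecomposition_dualCoplanarCut hZ hL, 1, one_ne_zero, fun A B _ => by
    simpa using fourPointForm_eq_sum_coplanar Z A B⟩

/-! ## Duality -/

theorem dualData_dotProduct (Z : Fin 4 → V4) (i : Fin 4) (Y : V4) :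
    dualData Z i ⬝ᵥ Y = br Y (prv Z i) (Z i) (nxt Z i) := by
  simp only [dotProduct, dualData, br_eq_det, det_four, Fin.sum_univ_four]
  simp
  ring

theorem br_mul_br (a b c d : V4) (Z : Fin 4 → V4) :
    br a b c d * br (Z 0) (Z 1) (Z 2) (Z 3) =
      (Matrix.of ![fun k => a ⬝ᵥ Z k, fun k => b ⬝ᵥ Z k, fun k => c ⬝ᵥ Z k,
        fun k => d ⬝ᵥ Z k]).det := by
  rw [← det_of_eq_br, ← Matrix.det_transpose (Matrix.of Z), br_eq_det, ← Matrix.det_mul]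
  congr 1
  ext i j
  fin_cases i <;> rfl

/-- Each covector kills the three basis vectors spanning its plane. The resulting signed permutation
matrix has determinant `D ^ 4`, which makes the bracket of the dual data positive. -/
theorem dualData_pairing {Z : Fin 4 → V4} {D : ℝ} (hD : br (Z 0) (Z 1) (Z 2) (Z 3) = D)
    (hD0 : D ≠ 0) (i k : Fin 4) :
    dualData Z i ⬝ᵥ Z k = (![![0, 0, -D, 0], ![0, 0, 0, -D], ![D, 0, 0, 0], ![0, D, 0, 0]] :
      Fin 4 → Fin 4 → ℝ) i k := by
  have h : br (Z 0) (Z 1) (Z 2) (Z 3) ≠ 0 := hD ▸ hD0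
  rw [dualData_dotProduct, br_eq_crd h, hD, det_four]
  fin_cases i <;> fin_cases k <;> simp [prv, nxt, crd_basis h]

theorem br_dualData_pos {Z : Fin 4 → V4} (hZ : 0 < br (Z 0) (Z 1) (Z 2) (Z 3)) :
    0 < br (dualData Z 0) (dualData Z 1) (dualData Z 2) (dualData Z 3) := by
  refine pos_of_mul_pos_left (b := br (Z 0) (Z 1) (Z 2) (Z 3)) ?_ hZ.le
  rw [br_mul_br, det_four]
  simp only [dualData_pairing rfl hZ.ne', Matrix.cons_val]
  have := pow_pos hZ 4
  ring_nf
  linarith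

theorem barBracket_meetLine {Z : Fin 4 → V4} (hZ : 0 < br (Z 0) (Z 1) (Z 2) (Z 3)) (P Q : V4)
    {i j : Fin 4} (hij : i < j) :
    barBracket (meetLine P Q) Z i j = br P Q (dualData Z i) (dualData Z j) := by
  -- Multiplied by the bracket of `Z`, the right side is a determinant of pairings of covectors with
  -- the `Z k`, which `dualData_pairing` evaluates.
  apply mul_right_cancel₀ hZ.ne'
  rw [br_mul_br, det_four]
  obtain ⟨D, hD⟩ : ∃ D, br (Z 0) (Z 1) (Z 2) (Z 3) = D := ⟨_, rfl⟩
  have h := hZ.ne'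
  have hbr : ∀ A B C E, br A B C E = D * (Matrix.of ![fun i => crd Z i A, fun i => crd Z i B,
      fun i => crd Z i C, fun i => crd Z i E]).det := by
    intro A B C E
    rw [br_eq_crd h, hD]
  simp only [dualData_pairing hD (hD ▸ h), hD]
  simp only [barBracket, planeBracket, meetLine, hbr, det_four]
  fin_cases i <;> fin_cases j <;> first
    | exact absurd hij (by decide)
    | (simp [prv, nxt, crd_basis h]; try ring)

theorem coplanarCut_eq {Z : Fin 4 → V4} (hZ : 0 < br (Z 0) (Z 1) (Z 2) (Z 3)) (L : ℕ) :
    coplanarCut Z L = dualCoplanarCut (dualData Z) L := by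
  ext x
  refine forall_congr' fun α => forall_congr' fun i => forall_congr' fun j =>
    forall_congr' fun hij => ?_
  rw [barBracket_meetLine hZ _ _ hij]

end

end LoopCut

theorem mainTheorem1 (Z : Fin 4 → V4) (hZ : 0 < br (Z 0) (Z 1) (Z 2) (Z 3)) :
    (∀ L : ℕ, 1 ≤ L →
      IsCellDecomposition (intersectingCut Z L) (interCell Z) ∧
      (∀ (A : V4) (B : Fin L → V4),
        fourPointForm Z A B = ∑ k, (interCell Z k).form A B) ∧
      IsCanonicalForm 1 (intersectingCut Z L) (fourPointForm Z)) ∧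
    (∀ L : ℕ, 1 ≤ L →
      IsCellDecomposition (dualCoplanarCut Z L) (coplanarCell Z) ∧
      (∀ (A : V4) (B : Fin L → V4),
        fourPointForm Z A B = (-1 : ℝ) ^ L * ∑ k, (coplanarCell Z k).form A B) ∧
      IsCanonicalForm ((-1) ^ L) (dualCoplanarCut Z L) (fourPointForm Z)) ∧
    (∀ L : ℕ, 1 ≤ L →
      coplanarCut Z L = dualCoplanarCut (dualData Z) L ∧
      IsCanonicalForm ((-1) ^ L) (coplanarCut Z L) (fourPointForm (dualData Z))) := by
  refine ⟨fun L hL => ⟨isCellDecomposition_intersectingCut hZ hL,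
      fourPointForm_eq_sum_inter Z, isCanonicalForm_intersectingCut hZ hL⟩,
    fun L hL => ⟨isCellDecomposition_dualCoplanarCut hZ hL,
      fourPointForm_eq_sum_coplanar Z, isCanonicalForm_dualCoplanarCut hZ hL⟩,
    fun L hL => ⟨coplanarCut_eq hZ L, ?_⟩⟩
  rw [coplanarCut_eq hZ L]
  exact isCanonicalForm_dualCoplanarCut (br_dualData_pos hZ) hL
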